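/- Let $p$ be a prime, $q=p^h$, let $r\mid h$ with $r<h$, let $a,b,c\in\mathbb F_{p^r}\subset\mathbb F_q$ be non-zero with $c\neq -a/b$, and put $n=m=\frac{q-1}{p^r-1}$. Let $\mathcal F\subset\mathbb P^2$ be the projective closure of the affine curve $ax^ny^m+bx^n+cy^m=1$ over $\mathbb F_q$, that is, $aX^nY^m+bX^nZ^m+cY^mZ^n=Z^{m+n}$. Let $N_q(\mathcal F)$ denote the number of $\mathbb F_q$-rational points of $\mathcal F$, counted as $\mathbb F_q$-rational branches, i.e. as places of degree one of the function field $\mathbb F_q(\mathcal F)=\mathbb F_q(x,y)$ (equivalently, rational points of the nonsingular model). Then $\mathcal F$ is geometrically irreducible and \[ N_q(\mathcal F)=n^2(p^r-3)+4n . \] Moreover, the only singular points of $\mathcal F$ over $\overline{\mathbb F}_q$ are $(1:0:0)$ and $(0:1:0)$; each of them is an ordinary singular point of multiplicity $n$ (it has $n$ distinct tangent lines), and exactly $n$ of the $\mathbb F_q$-rational branches counted by $N_q(\mathcal F)$ are centred at each of them. -/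

import Mathlib

noncomputable section

/-- A plane affine curve `f(x, y) = 0` over a field `F` (equivalently, its projective closure) is
geometrically irreducible if `f` is irreducible over the algebraic closure of `F`. -/
class GeomIrreducible {F : Type*} [Field F] (f : MvPolynomial (Fin 2) F) : Prop where
  irreducible_map : Irreducible (MvPolynomial.map (algebraMap F (AlgebraicClosure F)) f)

/-- The coordinate ring `F[x, y] / (f)`. -/
abbrev CurveCoordinateRing {F : Type*} [Field F] (f : MvPolynomial (Fin 2) F) : Type _ :=
  MvPolynomial (Fin 2) F ⧸ Ideal.span {f}

theorem GeomIrreducible.irreducible {F : Type*} [Field F] (f : MvPolynomial (Fin 2) F)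
    [h : GeomIrreducible f] : Irreducible f := by
  have hloc : IsLocalHom (MvPolynomial.map (σ := Fin 2) (algebraMap F (AlgebraicClosure F))) := by
    refine ⟨fun g hg => ?_⟩
    obtain ⟨r, hr, hgr⟩ := MvPolynomial.isUnit_iff_eq_C_of_isReduced.mp hg
    have hinj := MvPolynomial.map_injective (σ := Fin 2) _
      (algebraMap F (AlgebraicClosure F)).injective
    have hgC : g = MvPolynomial.C (MvPolynomial.coeff 0 g) := by
      apply hinj
      rw [MvPolynomial.map_C, ← MvPolynomial.coeff_map, hgr, MvPolynomial.coeff_C, if_pos rfl]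
    rw [hgC]
    refine IsUnit.map _ (isUnit_iff_ne_zero.mpr fun h0 => ?_)
    rw [h0, map_zero] at hgC
    rw [hgC, map_zero] at hg
    exact not_isUnit_zero hg
  exact Irreducible.of_map h.irreducible_map

instance CurveCoordinateRing.instIsDomain {F : Type*} [Field F] (f : MvPolynomial (Fin 2) F)
    [GeomIrreducible f] : IsDomain (CurveCoordinateRing f) := by
  have hf := GeomIrreducible.irreducible f
  have : (Ideal.span {f}).IsPrime := (Ideal.span_singleton_prime hf.ne_zero).mpr hf.prime
  exact Ideal.Quotient.isDomain _

/-- The function field `F(x, y)`, `f(x, y) = 0`, of an irreducible plane curve. -/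
abbrev CurveFunctionField {F : Type*} [Field F] (f : MvPolynomial (Fin 2) F) : Type _ :=
  FractionRing (CurveCoordinateRing f)

/-- The homogeneous coordinate functions `(x : y : 1)` on the projective closure of the curve. -/
def curveCoordinates {F : Type*} [Field F] (f : MvPolynomial (Fin 2) F) :
    Fin 3 → CurveFunctionField f :=
  ![algebraMap (CurveCoordinateRing f) _ (Ideal.Quotient.mk _ (MvPolynomial.X 0)),
    algebraMap (CurveCoordinateRing f) _ (Ideal.Quotient.mk _ (MvPolynomial.X 1)), 1]

/-- The `F`-rational branches of the projective closure of `f(x, y) = 0`, i.e. the places of degree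
one of its function field: the valuation rings `F ⊆ O ⊊ F(x, y)` whose residue field is `F`. -/
def rationalBranches {F : Type*} [Field F] (f : MvPolynomial (Fin 2) F) [GeomIrreducible f] :
    Set (ValuationSubring (CurveFunctionField f)) :=
  {O | O ≠ ⊤ ∧ (∀ t : F, algebraMap F (CurveFunctionField f) t ∈ O) ∧
    ∀ z ∈ O, ∃ t : F, O.valuation (z - algebraMap F (CurveFunctionField f) t) < 1}

/-- The number of `F`-rational points of the projective closure of `f(x, y) = 0`, where, as usual,
a point is a point of the nonsingular model, that is, a branch. -/
def numRationalPoints {F : Type*} [Field F] (f : MvPolynomial (Fin 2) F) [GeomIrreducible f] : ℕ :=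
  (rationalBranches f).ncard

/-- The `F`-rational branches centred at the point `(v 0 : v 1 : v 2)` of the projective plane: the
quotients of the coordinate functions reduce to the quotients of the coordinates of the point. -/
def rationalBranchesAt {F : Type*} [Field F] (f : MvPolynomial (Fin 2) F) [GeomIrreducible f]
    (v : Fin 3 → F) : Set (ValuationSubring (CurveFunctionField f)) :=
  {O | O ∈ rationalBranches f ∧ ∃ i, v i ≠ 0 ∧ ∀ j,
    O.valuation (curveCoordinates f j / curveCoordinates f i
      - algebraMap F (CurveFunctionField f) (v j / v i)) < 1}

/-- `G = 0` is singular at the point of the projective plane with coordinate vector `v`. -/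
def IsSingularPoint {k : Type*} [Field k] (G : MvPolynomial (Fin 3) k) (v : Fin 3 → k) : Prop :=
  MvPolynomial.eval v G = 0 ∧ ∀ i, MvPolynomial.eval v (MvPolynomial.pderiv i G) = 0

/-- `(v 0 : v 1 : v 2)` is an ordinary `m`-fold point of `G = 0` (`k` algebraically closed): the
initial form of `G (v + W)`, whose zeros are the tangent lines, is a product of `m` pairwise
non-proportional linear forms in `W`. -/
def IsOrdinaryMultiplePoint {k : Type*} [Field k] (G : MvPolynomial (Fin 3) k) (v : Fin 3 → k)
    (m : ℕ) : Prop :=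
  2 ≤ m ∧ ∃ l : Fin m → Fin 3 → k,
    (∀ i j, i ≠ j → LinearIndependent k ![l i, l j]) ∧
    MvPolynomial.aeval (fun s => MvPolynomial.C (v s) + MvPolynomial.X s) G
        - ∏ i, ∑ s, MvPolynomial.C (l i s) * MvPolynomial.X s
      ∈ Ideal.span (Set.range (MvPolynomial.X : Fin 3 → MvPolynomial (Fin 3) k)) ^ (m + 1)

/-- The affine equation `a x ^ n * y ^ m + b x ^ n + c y ^ m - 1`. -/
def genFermatAffine {F : Type*} [Field F] (a b c : F) (n m : ℕ) : MvPolynomial (Fin 2) F :=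
  MvPolynomial.C a * MvPolynomial.X 0 ^ n * MvPolynomial.X 1 ^ m
    + MvPolynomial.C b * MvPolynomial.X 0 ^ n + MvPolynomial.C c * MvPolynomial.X 1 ^ m - 1

/-- The equation of its projective closure:
`a X ^ n * Y ^ m + b X ^ n * Z ^ m + c Y ^ m * Z ^ n - Z ^ (m + n)`. -/
def genFermatProj {F : Type*} [Field F] (a b c : F) (n m : ℕ) : MvPolynomial (Fin 3) F :=
  MvPolynomial.C a * MvPolynomial.X 0 ^ n * MvPolynomial.X 1 ^ m
    + MvPolynomial.C b * MvPolynomial.X 0 ^ n * MvPolynomial.X 2 ^ m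
    + MvPolynomial.C c * MvPolynomial.X 1 ^ m * MvPolynomial.X 2 ^ n
    - MvPolynomial.X 2 ^ (m + n)

end

-- Write the curve as `(a x^n + c) y^n = 1 - b x^n`, and let `d = p^r - 1`, so that `q = n d + 1`.
-- Then `n d = -1` in `F`, hence `n ≠ 0` there. The excluded value of `c` means `a + b c ≠ 0`. On
-- the curve `(a x^n + c)(a y^n + b) = a + b c`, so neither factor vanishes at an affine point; this
-- nonvanishing gives smoothness of the affine part.
--
-- Irreducibility is Eisenstein at a simple zero of `c y^n - 1`. The partial derivatives exclude
-- affine singular points, and the local expansions at `(1:0:0)` and `(0:1:0)` have initial forms `a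
-- Y^n + b Z^n` and `a X^n + c Z^n`, which split into `n` distinct lines.
--
-- For the affine count, `x^n` lies in the subfield `k` of order `p^r`, and every nonzero element of
-- `k` has exactly `n` `n`-th roots in `F`. Hence every `x` has `n` points above it, except for `n`
-- values with none and `n` values with one: in all `n^2 (d - 2) + 2n` points
-- (`ncard_genFermatPoints`).
--
-- A rational affine point is the centre of exactly one place of degree one, because its local ring
-- is Noetherian with principal maximal ideal (`IsPlaneModel.existsUnique_place`). For places at
-- infinity, `x ↦ 1/x` carries the curve to another curve of the same family (`IsPlaneModel.inv`).
-- The poles of `x` thus become the affine points `(0, t)` with `t^n = -b/a`, and there are `n` of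
-- them. The poles of `y` follow by symmetry, and no place is a pole of both. These `2n` places
-- complete the count and are the branches at the two singular points.

universe u

noncomputable section

/-! ### Geometric irreducibility -/

/-- Eisenstein's criterion at `P`; `hAB` supplies primitivity. -/
theorem Polynomial.irreducible_C_mul_X_pow_add_C {R : Type*} [CommRing R] [IsDomain R]
    {P : Ideal R} (hP : P.IsPrime) {A B : R} {n : ℕ} (hn : 0 < n) (hA : A ∉ P) (hB : B ∈ P)
    (hB2 : B ∉ P ^ 2) (hAB : ∀ d, d ∣ A → d ∣ B → IsUnit d) :
    Irreducible (Polynomial.C A * Polynomial.X ^ n + Polynomial.C B) := by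
  have hA0 : A ≠ 0 := fun h => hA (h ▸ P.zero_mem)
  have hdeg : (Polynomial.C B).degree < (Polynomial.C A * Polynomial.X ^ n).degree := by
    rw [Polynomial.degree_C_mul_X_pow n hA0]
    exact Polynomial.degree_C_le.trans_lt (by exact_mod_cast hn)
  have hd : (Polynomial.C A * Polynomial.X ^ n + Polynomial.C B).degree = (n : WithBot ℕ) := by
    rw [Polynomial.degree_add_eq_left_of_degree_lt hdeg, Polynomial.degree_C_mul_X_pow n hA0]
  refine Polynomial.irreducible_of_eisenstein_criterion hP ?_ ?_ ?_ ?_ ?_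
  · rw [Polynomial.leadingCoeff_add_of_degree_lt' hdeg]
    simpa using hA
  · intro i hi
    rw [hd] at hi
    have hi : i < n := by exact_mod_cast hi
    rw [Polynomial.coeff_add, Polynomial.coeff_C_mul_X_pow, if_neg hi.ne, zero_add,
      Polynomial.coeff_C]
    split_ifs
    · exact hB
    · exact P.zero_mem
  · rw [hd]; exact_mod_cast hn
  · simpa [Polynomial.coeff_X_pow, hn.ne] using hB2
  · intro d hd
    rw [Polynomial.C_dvd_iff_dvd_coeff] at hd
    refine hAB d ?_ ?_
    · simpa [Polynomial.coeff_C, hn.ne'] using hd n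
    · simpa [Polynomial.coeff_X_pow, hn.ne] using hd 0

/-- By the product rule. A nonzero derivative at a zero therefore certifies the Eisenstein condition
that the constant term is not in `P ^ 2`. -/
theorem MvPolynomial.eval_pderiv_eq_zero_of_mem_ker_sq {σ K : Type*} [CommRing K] (v : σ → K)
    (i : σ) {g : MvPolynomial σ K} (hg : g ∈ RingHom.ker (MvPolynomial.eval v) ^ 2) :
    MvPolynomial.eval v (MvPolynomial.pderiv i g) = 0 := by
  rw [pow_two] at hg
  refine Submodule.mul_induction_on hg (fun s hs t ht => ?_) (fun s t hs ht => ?_)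
  · rw [RingHom.mem_ker] at hs ht
    simp [Derivation.leibniz, hs, ht]
  · simp [hs, ht]

/-- `finSuccEquiv` makes `x` the main variable, giving `(a y^n + b) x^n + (c y^n - 1)` over `K[y]`.
The Eisenstein prime is the point `y = t` with `c t^n = 1`: there `a t^n + b = (a + b c) / c ≠ 0`,
and the zero of `c y^n - 1` is simple since `n ≠ 0` in `K`. -/
theorem irreducible_genFermatAffine {K : Type*} [Field K] [IsAlgClosed K] {a b c : K} {n : ℕ}
    (hc : c ≠ 0) (habc : a + b * c ≠ 0) (hn : (n : K) ≠ 0) :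
    Irreducible (genFermatAffine a b c n n) := by
  have hn0 : n ≠ 0 := by rintro rfl; simp at hn
  obtain ⟨t, ht⟩ := IsAlgClosed.exists_pow_nat_eq c⁻¹ (Nat.pos_of_ne_zero hn0)
  have ht0 : t ≠ 0 := by
    rintro rfl
    rw [zero_pow hn0] at ht
    exact inv_ne_zero hc ht.symm
  have key : MvPolynomial.finSuccEquiv K 1 (genFermatAffine a b c n n) =
      Polynomial.C (MvPolynomial.C a * MvPolynomial.X 0 ^ n + MvPolynomial.C b) * Polynomial.X ^ n
        + Polynomial.C (MvPolynomial.C c * MvPolynomial.X 0 ^ n - 1) := by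
    have h1 : (1 : Fin 2) = Fin.succ 0 := rfl
    simp only [genFermatAffine, map_add, map_sub, map_mul, map_pow, map_one, h1,
      MvPolynomial.finSuccEquiv_X_zero, MvPolynomial.finSuccEquiv_X_succ]
    simp only [MvPolynomial.finSuccEquiv_apply, MvPolynomial.eval₂Hom_C, RingHom.comp_apply]
    ring
  rw [← MulEquiv.irreducible_iff (MvPolynomial.finSuccEquiv K 1), key]
  refine Polynomial.irreducible_C_mul_X_pow_add_C
    (P := RingHom.ker (MvPolynomial.eval fun _ : Fin 1 => t)) (RingHom.ker_isPrime _)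
    (Nat.pos_of_ne_zero hn0) ?_ ?_ ?_ ?_
  · rw [RingHom.mem_ker]
    simp only [map_add, map_mul, map_pow, MvPolynomial.eval_C, MvPolynomial.eval_X, ht]
    intro h
    apply habc
    field_simp at h
    linear_combination h
  · rw [RingHom.mem_ker]
    simp [ht, hc]
  · intro h
    have := MvPolynomial.eval_pderiv_eq_zero_of_mem_ker_sq _ 0 h
    simp [Derivation.leibniz, Derivation.leibniz_pow, hc, hn, ht0] at this
  · intro d h1 h2
    -- The combination `c (a y^n + b) - a (c y^n - 1)` eliminates `y`.
    have h3 : d ∣ MvPolynomial.C (a + b * c) := by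
      have := dvd_sub (h1.mul_left (MvPolynomial.C c)) (h2.mul_left (MvPolynomial.C a))
      convert this using 1
      simp only [map_add, map_mul]
      ring
    exact isUnit_of_dvd_unit h3 ((isUnit_iff_ne_zero.mpr habc).map MvPolynomial.C)

theorem map_genFermatAffine {F K : Type*} [Field F] [Field K] (φ : F →+* K) (a b c : F)
    (n m : ℕ) : MvPolynomial.map φ (genFermatAffine a b c n m)
      = genFermatAffine (φ a) (φ b) (φ c) n m := by
  simp [genFermatAffine]

theorem map_genFermatProj {F K : Type*} [Field F] [Field K] (φ : F →+* K) (a b c : F)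
    (n m : ℕ) : MvPolynomial.map φ (genFermatProj a b c n m)
      = genFermatProj (φ a) (φ b) (φ c) n m := by
  simp [genFermatProj]

theorem geomIrreducible_genFermatAffine {F : Type*} [Field F] {a b c : F} {n : ℕ}
    (hc : c ≠ 0) (habc : a + b * c ≠ 0) (hn : (n : F) ≠ 0) :
    GeomIrreducible (genFermatAffine a b c n n) := by
  refine ⟨?_⟩
  rw [map_genFermatAffine]
  refine irreducible_genFermatAffine ?_ ?_ ?_
  · rwa [map_ne_zero]
  · rwa [← map_mul, ← map_add, map_ne_zero]
  · rwa [← map_natCast (algebraMap F (AlgebraicClosure F)), map_ne_zero]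

/-! ### Singular points and their tangents -/

theorem isSingularPoint_genFermatProj_iff {K : Type*} [Field K] {a b c : K} {n : ℕ}
    (ha : a ≠ 0) (hb : b ≠ 0) (hc : c ≠ 0) (habc : a + b * c ≠ 0) (hn : (n : K) ≠ 0)
    (hn2 : 2 ≤ n) (v : Fin 3 → K) :
    IsSingularPoint (genFermatProj a b c n n) v ↔
      (v 1 = 0 ∧ v 2 = 0) ∨ (v 0 = 0 ∧ v 2 = 0) := by
  have hn0 : n ≠ 0 := by omega
  have hn1 : n - 1 ≠ 0 := by omega
  have hnn : n + n - 1 ≠ 0 := by omega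
  simp only [IsSingularPoint, Fin.forall_fin_succ, genFermatProj]
  simp [Derivation.leibniz, Derivation.leibniz_pow, MvPolynomial.pderiv_X, Pi.single_apply]
  constructor
  · rintro ⟨h, h0, h1, h2⟩
    by_cases z : v 2 = 0
    · simp [z, hn0, ha] at h
      tauto
    · exfalso
      by_cases x : v 0 = 0
      · simp [x, hn0] at h h1
        have hy : v 1 ≠ 0 := by
          intro hy
          simp [hy, hn0] at h
          exact z h
        simp [hy, z, hn, hc] at h1
      · by_cases y : v 1 = 0
        · simp [y, hn0] at h h0
          simp [x, z, hn, hb] at h0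
        · have e0 : a * v 1 ^ n + b * v 2 ^ n = 0 := by
            have : (n * v 0 ^ (n - 1)) * (a * v 1 ^ n + b * v 2 ^ n) = 0 := by
              linear_combination h0
            exact (mul_eq_zero.mp this).resolve_left (by simp [hn, x])
          have e1 : a * v 0 ^ n + c * v 2 ^ n = 0 := by
            have : (n * v 1 ^ (n - 1)) * (a * v 0 ^ n + c * v 2 ^ n) = 0 := by
              linear_combination h1
            exact (mul_eq_zero.mp this).resolve_left (by simp [hn, y])
          -- With `G` the form, `(a X^n + c Z^n)(a Y^n + b Z^n) = a G + (a + b c) Z^(2n)`.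
          have : (a + b * c) * (v 2 ^ n) ^ 2 = 0 := by
            rw [pow_add] at h
            linear_combination (a * v 0 ^ n + c * v 2 ^ n) * e0 - a * h
          simp [habc, z] at this
  · rintro (⟨h1, h2⟩ | ⟨h1, h2⟩) <;> simp [h1, h2, hn0, hn1, hnn]

/-- With `δ^n = α` and `γ^n = -β/α`, the factors are `δ (X_p - ξ γ X_q)` for the `n`-th roots of
unity `ξ`. There are `n` distinct ones because `n ≠ 0` in `K`. -/
theorem exists_prod_linearForm_eq_binomial {K : Type*} [Field K] [IsAlgClosed K] {α β : K}
    {n : ℕ} (hα : α ≠ 0) (hβ : β ≠ 0) (hn : (n : K) ≠ 0) {σ : Type*} [Fintype σ] [DecidableEq σ]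
    {p q : σ} (hpq : p ≠ q) :
    ∃ l : Fin n → σ → K, (∀ i j, i ≠ j → LinearIndependent K ![l i, l j]) ∧
      ∏ i, ∑ s, MvPolynomial.C (l i s) * MvPolynomial.X s
        = MvPolynomial.C α * MvPolynomial.X p ^ n + MvPolynomial.C β * MvPolynomial.X q ^ n := by
  have hn0 : n ≠ 0 := by rintro rfl; simp at hn
  have hpos := Nat.pos_of_ne_zero hn0
  have : NeZero (n : K) := ⟨hn⟩
  obtain ⟨ζ, hζ⟩ := HasEnoughRootsOfUnity.exists_primitiveRoot K n
  obtain ⟨δ, hδ⟩ := IsAlgClosed.exists_pow_nat_eq α hpos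
  obtain ⟨γ, hγ⟩ := IsAlgClosed.exists_pow_nat_eq (-β / α) hpos
  have hδ0 : δ ≠ 0 := by
    rintro rfl; rw [zero_pow hn0] at hδ; exact hα hδ.symm
  have hγ0 : γ ≠ 0 := by
    rintro rfl; rw [zero_pow hn0] at hγ
    exact div_ne_zero (neg_ne_zero.mpr hβ) hα hγ.symm
  let e := (Polynomial.nthRootsFinset n (1 : K)).equivFinOfCardEq hζ.card_nthRootsFinset
  let ω : Fin n → K := fun i => (e.symm i : K) * γ
  have hω : Function.Injective ω := fun i j h =>
    e.symm.injective (Subtype.ext (mul_right_cancel₀ hγ0 h))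
  refine ⟨fun i => δ • (Pi.single p 1 - ω i • Pi.single q 1), fun i j hij => ?_, ?_⟩
  · rw [LinearIndependent.pair_iff]
    intro s t hst
    have h1 := congrFun hst p
    have h2 := congrFun hst q
    simp [hpq, hpq.symm] at h1 h2
    have h3 : δ * (s + t) = 0 := by linear_combination h1
    have h4 : s + t = 0 := (mul_eq_zero.mp h3).resolve_left hδ0
    have h5 : δ * (ω i - ω j) * s = 0 := by linear_combination -h2 - ω j * δ * h4
    have hs : s = 0 :=
      (mul_eq_zero.mp h5).resolve_left (mul_ne_zero hδ0 (sub_ne_zero.mpr (hω.ne hij)))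
    exact ⟨hs, by simpa [hs] using h4⟩
  · have : Infinite K := IsAlgClosed.instInfinite
    refine MvPolynomial.funext fun v => ?_
    have h1 : ∀ i, ∑ s, (δ • (Pi.single p 1 - ω i • Pi.single q 1) : σ → K) s * v s
        = δ * (v p - (e.symm i : K) * (γ * v q)) := by
      intro i
      simp only [Pi.smul_apply, Pi.sub_apply, smul_eq_mul, mul_assoc, ← Finset.mul_sum, sub_mul,
        Finset.sum_sub_distrib, Pi.single_apply, ite_mul, one_mul, zero_mul, Finset.sum_ite_eq',
        Finset.mem_univ, if_true, ω]
    simp only [map_prod, map_sum, map_mul, map_add, map_pow, MvPolynomial.eval_C,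
      MvPolynomial.eval_X]
    rw [Finset.prod_congr rfl fun i _ => h1 i, Finset.prod_mul_distrib, Finset.prod_const,
      Finset.card_univ, Fintype.card_fin, hδ,
      Equiv.prod_comp e.symm fun ξ => v p - (ξ : K) * (γ * v q),
      Finset.prod_coe_sort _ fun ξ => v p - ξ * (γ * v q),
      ← hζ.pow_sub_pow_eq_prod_sub_mul _ _ hpos, mul_pow, hγ]
    field_simp
    ring

theorem isOrdinaryMultiplePoint_of_forall_sub_mem {K : Type*} [Field K] [IsAlgClosed K]
    {α β : K} {n : ℕ} (hα : α ≠ 0) (hβ : β ≠ 0) (hn : (n : K) ≠ 0) (hn2 : 2 ≤ n) {p q : Fin 3}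
    (hpq : p ≠ q) {G : MvPolynomial (Fin 3) K} {v : Fin 3 → K}
    (hG : MvPolynomial.aeval (fun s => MvPolynomial.C (v s) + MvPolynomial.X s) G
        - (MvPolynomial.C α * MvPolynomial.X p ^ n + MvPolynomial.C β * MvPolynomial.X q ^ n)
      ∈ Ideal.span (Set.range (MvPolynomial.X : Fin 3 → MvPolynomial (Fin 3) K)) ^ (n + 1)) :
    IsOrdinaryMultiplePoint G v n := by
  obtain ⟨l, hl, h⟩ := exists_prod_linearForm_eq_binomial hα hβ hn hpq
  exact ⟨hn2, l, hl, h ▸ hG⟩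

/-- Since `x` divides `(1 + x)^n - 1`, the first term has order at least `n + 1`; the others have
order at least `2n`. This is the tail of the expansion at either point at infinity. -/
theorem Ideal.binomial_expansion_mem_pow_succ {R : Type*} [CommRing R] {I : Ideal R}
    {x y z : R} (hx : x ∈ I) (hy : y ∈ I) (hz : z ∈ I) {n : ℕ} (hn : 1 ≤ n) (a b c d : R) :
    ((1 + x) ^ n - 1) * (a * y ^ n + b * z ^ n) + c * (y ^ n * z ^ n) + d * z ^ (n + n)
      ∈ I ^ (n + 1) := by
  have hle : I ^ (n + n) ≤ I ^ (n + 1) := Ideal.pow_le_pow_right (by omega)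
  have h1 : (1 + x) ^ n - 1 ∈ I := by
    have : 1 + x - 1 ∣ (1 + x) ^ n - 1 := sub_one_dvd_pow_sub_one _ _
    exact I.mem_of_dvd this (by simpa using hx)
  refine add_mem (add_mem ?_ (Ideal.mul_mem_left _ _ (hle ?_))) (Ideal.mul_mem_left _ _ (hle ?_))
  · rw [pow_succ']
    exact Ideal.mul_mem_mul h1 (add_mem (Ideal.mul_mem_left _ _ (Ideal.pow_mem_pow hy n))
      (Ideal.mul_mem_left _ _ (Ideal.pow_mem_pow hz n)))
  · rw [pow_add]
    exact Ideal.mul_mem_mul (Ideal.pow_mem_pow hy n) (Ideal.pow_mem_pow hz n)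
  · exact Ideal.pow_mem_pow hz _

theorem isOrdinaryMultiplePoint_genFermatProj_fst {K : Type*} [Field K] [IsAlgClosed K]
    {a b : K} (c : K) {n : ℕ} (ha : a ≠ 0) (hb : b ≠ 0) (hn : (n : K) ≠ 0) (hn2 : 2 ≤ n) :
    IsOrdinaryMultiplePoint (genFermatProj a b c n n) ![1, 0, 0] n := by
  refine isOrdinaryMultiplePoint_of_forall_sub_mem ha hb hn hn2 (p := 1) (q := 2) (by decide) ?_
  have hX (i : Fin 3) : MvPolynomial.X i ∈
      Ideal.span (Set.range (MvPolynomial.X : Fin 3 → MvPolynomial (Fin 3) K)) :=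
    Ideal.subset_span ⟨i, rfl⟩
  convert Ideal.binomial_expansion_mem_pow_succ (hX 0) (hX 1) (hX 2) (one_le_two.trans hn2)
    (MvPolynomial.C a) (MvPolynomial.C b) (MvPolynomial.C c) (-1) using 1
  simp [genFermatProj, MvPolynomial.algebraMap_eq]
  ring

theorem isOrdinaryMultiplePoint_genFermatProj_snd {K : Type*} [Field K] [IsAlgClosed K]
    {a c : K} (b : K) {n : ℕ} (ha : a ≠ 0) (hc : c ≠ 0) (hn : (n : K) ≠ 0) (hn2 : 2 ≤ n) :
    IsOrdinaryMultiplePoint (genFermatProj a b c n n) ![0, 1, 0] n := by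
  refine isOrdinaryMultiplePoint_of_forall_sub_mem ha hc hn hn2 (p := 0) (q := 2) (by decide) ?_
  have hX (i : Fin 3) : MvPolynomial.X i ∈
      Ideal.span (Set.range (MvPolynomial.X : Fin 3 → MvPolynomial (Fin 3) K)) :=
    Ideal.subset_span ⟨i, rfl⟩
  convert Ideal.binomial_expansion_mem_pow_succ (hX 1) (hX 0) (hX 2) (one_le_two.trans hn2)
    (MvPolynomial.C a) (MvPolynomial.C c) (MvPolynomial.C b) (-1) using 1
  simp [genFermatProj, MvPolynomial.algebraMap_eq]
  ring

/-! ### Counting affine rational points -/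

/-- As `e^d = 1`, the polynomial `X^n - e` divides `X^(nd) - 1`, hence `X^q - X`, which splits with
simple roots in `F`. -/
theorem FiniteField.ncard_pow_eq {F : Type*} [Field F] [Fintype F] {n d : ℕ}
    (hnd : Fintype.card F = n * d + 1) {e : F} (he : e ^ d = 1) :
    {y : F | y ^ n = e}.ncard = n := by
  classical
  have hq := Fintype.one_lt_card (α := F)
  have hn : 0 < n := Nat.pos_of_ne_zero (by rintro rfl; simp at hnd; omega)
  have hdvd : (Polynomial.X ^ n - Polynomial.C e) ∣
      (Polynomial.X ^ Fintype.card F - Polynomial.X : Polynomial F) := by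
    have h1 := sub_dvd_pow_sub_pow (Polynomial.X ^ n : Polynomial F) (Polynomial.C e) d
    rw [← map_pow, he, map_one, ← pow_mul] at h1
    have h2 : (Polynomial.X ^ Fintype.card F - Polynomial.X : Polynomial F)
        = (Polynomial.X ^ (n * d) - 1) * Polynomial.X := by rw [hnd]; ring
    rw [h2]
    exact h1.mul_right _
  have hne : (Polynomial.X ^ Fintype.card F - Polynomial.X : Polynomial F) ≠ 0 :=
    FiniteField.X_pow_card_sub_X_ne_zero F hq
  have hroots := FiniteField.roots_X_pow_card_sub_X F
  have hsplit : (Polynomial.X ^ Fintype.card F - Polynomial.X : Polynomial F).Splits := by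
    rw [Polynomial.splits_iff_card_roots, hroots, FiniteField.X_pow_card_sub_X_natDegree_eq F hq]
    rfl
  have hs := hsplit.of_dvd hne hdvd
  have hnodup : (Polynomial.X ^ n - Polynomial.C e).roots.Nodup :=
    Multiset.nodup_of_le (Polynomial.roots.le_of_dvd hne hdvd) (hroots ▸ Finset.univ.nodup)
  have hset : {y : F | y ^ n = e} = (Polynomial.X ^ n - Polynomial.C e).roots.toFinset := by
    ext y
    simp [Polynomial.mem_roots (Polynomial.X_pow_sub_C_ne_zero hn e), sub_eq_zero]
  rw [hset, Set.ncard_coe_finset, Multiset.toFinset_card_of_nodup hnodup,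
    Polynomial.splits_iff_card_roots.mp hs, Polynomial.natDegree_X_pow_sub_C]

theorem Subfield.pow_eq_one_of_natCard {F : Type*} [Field F] [Finite F] {k : Subfield F} {d : ℕ}
    (hk : Nat.card k = d + 1) {e : F} (he : e ∈ k) (he0 : e ≠ 0) : e ^ d = 1 := by
  have := Fintype.ofFinite k
  have h := FiniteField.pow_card_sub_one_eq_one (⟨e, he⟩ : k) (by simpa [Subtype.ext_iff] using he0)
  rw [← Nat.card_eq_fintype_card, hk, Nat.add_sub_cancel] at h
  simpa [Subtype.ext_iff] using h

/-- The nonzero elements of `k` are `d` solutions of `y^d = 1`, so they are all of them; and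
`(x^n)^d = x^(q-1) = 1` for `x ≠ 0`. -/
theorem Subfield.pow_mem_of_card {F : Type*} [Field F] [Fintype F] {k : Subfield F} {n d : ℕ}
    (hF : Fintype.card F = n * d + 1) (hk : Nat.card k = d + 1) (x : F) : x ^ n ∈ k := by
  rcases eq_or_ne x 0 with rfl | hx
  · rcases Nat.eq_zero_or_pos n with rfl | hn
    · simp [k.one_mem]
    · rw [zero_pow hn.ne']; exact k.zero_mem
  have hsub : (k : Set F) \ {0} ⊆ {y : F | y ^ d = 1} := fun e he =>
    Subfield.pow_eq_one_of_natCard hk he.1 he.2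
  have hcard : {y : F | y ^ d = 1}.ncard ≤ ((k : Set F) \ {0}).ncard := by
    rw [FiniteField.ncard_pow_eq (d := n) (by rw [hF, mul_comm]) (one_pow n),
      Set.ncard_sdiff_singleton_of_mem k.zero_mem]
    have : (k : Set F).ncard = d + 1 := hk
    omega
  have heq := Set.eq_of_subset_of_ncard_le hsub hcard (Set.toFinite _)
  have : x ^ n ∈ {y : F | y ^ d = 1} := by
    have h := FiniteField.pow_card_sub_one_eq_one x hx
    rw [hF, Nat.add_sub_cancel] at h
    simpa [← pow_mul] using h
  rw [← heq] at this
  exact this.1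

/-- The `F`-rational points of the affine curve. -/
def genFermatPoints {F : Type*} [Field F] (a b c : F) (n : ℕ) : Set (F × F) :=
  {P | a * P.1 ^ n * P.2 ^ n + b * P.1 ^ n + c * P.2 ^ n - 1 = 0}

theorem ncard_genFermatPoints {F : Type*} [Field F] [Fintype F] {k : Subfield F} {n d : ℕ}
    (hF : Fintype.card F = n * d + 1) (hk : Nat.card k = d + 1) {a b c : F}
    (hak : a ∈ k) (hbk : b ∈ k) (hck : c ∈ k) (ha : a ≠ 0) (hb : b ≠ 0) (hc : c ≠ 0)
    (habc : a + b * c ≠ 0) (hn : n ≠ 0) :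
    ((genFermatPoints a b c n).ncard : ℤ) = n ^ 2 * (d - 2) + 2 * n := by
  classical
  have hroot : ∀ e ∈ k, e ≠ 0 → {y : F | y ^ n = e}.ncard = n := fun e he he0 =>
    FiniteField.ncard_pow_eq hF (Subfield.pow_eq_one_of_natCard hk he he0)
  have hrootF : ∀ e ∈ k, e ≠ 0 → (Finset.univ.filter fun y : F => y ^ n = e).card = n := by
    intro e he he0
    rw [← Set.ncard_coe_finset]
    simpa using hroot e he he0
  -- The equation is `(a x^n + c) y^n = 1 - b x^n`. If the left factor vanishes there is no
  -- solution; if the right side vanishes only `y = 0` remains, a loss of `n - 1`. Both cannot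
  -- vanish, as `a + b c ≠ 0`.
  have hfib : ∀ x : F, ((Finset.univ.filter fun y : F =>
      a * x ^ n * y ^ n + b * x ^ n + c * y ^ n - 1 = 0).card : ℤ)
      = n - (if x ^ n = -c / a then (n : ℤ) else 0)
        - (if x ^ n = b⁻¹ then (n - 1 : ℤ) else 0) := by
    intro x
    have hx := Subfield.pow_mem_of_card hF hk x
    by_cases h1 : a * x ^ n + c = 0
    · have e1 : x ^ n = -c / a := by field_simp; linear_combination h1
      have e2 : x ^ n ≠ b⁻¹ := by
        intro h
        rw [h] at h1
        field_simp at h1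
        exact habc (by linear_combination h1)
      rw [if_pos e1, if_neg e2, Finset.card_eq_zero.mpr]
      · simp
      · rw [Finset.filter_eq_empty_iff]
        intro y _ h
        have : b * x ^ n = 1 := by linear_combination h - y ^ n * h1
        exact e2 (eq_inv_of_mul_eq_one_right this)
    · have e1 : x ^ n ≠ -c / a := by
        intro h; rw [h] at h1; field_simp at h1; simp at h1
      by_cases h2 : b * x ^ n = 1
      · have e2 : x ^ n = b⁻¹ := eq_inv_of_mul_eq_one_right h2
        rw [if_neg e1, if_pos e2]
        have : (Finset.univ.filter fun y : F =>
            a * x ^ n * y ^ n + b * x ^ n + c * y ^ n - 1 = 0) = {0} := by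
          ext y
          simp only [Finset.mem_filter, Finset.mem_univ, true_and, Finset.mem_singleton]
          have h3 : a * x ^ n * y ^ n + b * x ^ n + c * y ^ n - 1 = (a * x ^ n + c) * y ^ n := by
            linear_combination h2
          rw [h3, mul_eq_zero, or_iff_right h1, pow_eq_zero_iff hn]
        rw [this]
        simp
      · have e2 : x ^ n ≠ b⁻¹ := by
          intro h; rw [h] at h2; exact h2 (mul_inv_cancel₀ hb)
        rw [if_neg e1, if_neg e2]
        have : (Finset.univ.filter fun y : F =>
            a * x ^ n * y ^ n + b * x ^ n + c * y ^ n - 1 = 0)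
            = Finset.univ.filter fun y : F => y ^ n = (1 - b * x ^ n) / (a * x ^ n + c) := by
          ext y
          simp only [Finset.mem_filter, Finset.mem_univ, true_and]
          rw [eq_div_iff h1]
          constructor <;> intro h <;> linear_combination h
        rw [this, hrootF]
        · simp
        · exact k.div_mem (k.sub_mem k.one_mem (k.mul_mem hbk hx)) (k.add_mem (k.mul_mem hak hx) hck)
        · exact div_ne_zero (sub_ne_zero.mpr (Ne.symm h2)) h1
  have hcard : (genFermatPoints a b c n).ncard = ∑ x : F, (Finset.univ.filter fun y : F =>
      a * x ^ n * y ^ n + b * x ^ n + c * y ^ n - 1 = 0).card := by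
    have : genFermatPoints a b c n = ((Finset.univ.filter fun P : F × F =>
      a * P.1 ^ n * P.2 ^ n + b * P.1 ^ n + c * P.2 ^ n - 1 = 0 : Finset (F × F)) : Set (F × F)) := by
      ext P; simp [genFermatPoints]
    rw [this, Set.ncard_coe_finset, Finset.card_filter, Fintype.sum_prod_type]
    simp only [Finset.card_filter]
  rw [hcard]
  push_cast
  rw [Finset.sum_congr rfl fun x _ => hfib x, Finset.sum_sub_distrib, Finset.sum_sub_distrib,
    ← Finset.sum_filter, ← Finset.sum_filter, Finset.sum_const, Finset.sum_const, Finset.sum_const,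
    hrootF _ (k.div_mem (k.neg_mem hck) hak) (div_ne_zero (neg_ne_zero.mpr hc) ha),
    hrootF _ (k.inv_mem hbk) (inv_ne_zero hb), Finset.card_univ, hF]
  simp only [nsmul_eq_mul]
  push_cast
  ring

/-! ### Valuation rings and the place centred at a simple point -/

/-- The valuation rings `F ⊆ O ⊊ L` with residue field `F`. -/
def degreeOnePlaces (F L : Type*) [Field F] [Field L] [Algebra F L] : Set (ValuationSubring L) :=
  {O | O ≠ ⊤ ∧ (∀ t : F, algebraMap F L t ∈ O) ∧
    ∀ z ∈ O, ∃ t : F, O.valuation (z - algebraMap F L t) < 1}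

namespace ValuationSubring

variable {L : Type*} [Field L] (O : ValuationSubring L)

theorem mem_of_valuation_lt_one {z : L} (h : O.valuation z < 1) : z ∈ O :=
  O.mem_of_valuation_le_one _ h.le

theorem inv_notMem_of_valuation_lt_one {z : L} (hz : z ≠ 0) (h : O.valuation z < 1) :
    z⁻¹ ∉ O := by
  rw [← O.valuation_le_one_iff, map_inv₀, not_le]
  exact (one_lt_inv₀ (by simpa [zero_lt_iff] using hz)).mpr h

theorem valuation_inv_lt_one_iff {z : L} (hz : z ≠ 0) : O.valuation z⁻¹ < 1 ↔ z ∉ O := by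
  rw [← O.valuation_le_one_iff, map_inv₀, not_le]
  exact inv_lt_one₀ (by simpa [zero_lt_iff] using hz)

theorem valuation_sub_lt_one_trans {x y z : L} (h : O.valuation (x - y) < 1)
    (h' : O.valuation (y - z) < 1) : O.valuation (x - z) < 1 := by
  rw [← sub_add_sub_cancel x y z]
  exact O.valuation.map_add_lt h h'

theorem valuation_mul_lt_one_of_mem {x y : L} (hx : x ∈ O) (hy : O.valuation y < 1) :
    O.valuation (x * y) < 1 := by
  rw [map_mul]
  exact (mul_le_of_le_one_left' ((O.valuation_le_one_iff x).mpr hx)).trans_lt hy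

theorem eq_of_valuation_algebraMap_sub_lt_one {F : Type*} [Field F] [Algebra F L]
    (hO : ∀ t : F, algebraMap F L t ∈ O) {x : L} {s t : F}
    (hs : O.valuation (x - algebraMap F L s) < 1) (ht : O.valuation (x - algebraMap F L t) < 1) :
    s = t := by
  by_contra hst
  have h : O.valuation (algebraMap F L (s - t)) < 1 := by
    rw [map_sub]
    rw [Valuation.map_sub_swap] at hs
    exact O.valuation_sub_lt_one_trans hs ht
  refine O.inv_notMem_of_valuation_lt_one ?_ h ?_
  · simpa [sub_eq_zero] using hst
  · rw [← map_inv₀]; exact hO _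

/-- A valuation ring dominated by another valuation ring is equal to it. -/
theorem eq_of_le_of_forall_valuation_lt_one {O O' : ValuationSubring L} (h : O ≤ O')
    (hv : ∀ z, O.valuation z < 1 → O'.valuation z < 1) : O = O' := by
  refine le_antisymm h fun z hz => ?_
  by_contra hzO
  have hz0 : z ≠ 0 := fun h0 => hzO (h0 ▸ O.zero_mem)
  have := hv _ ((O.valuation_inv_lt_one_iff hz0).mpr hzO)
  rw [O'.valuation_inv_lt_one_iff hz0] at this
  exact this hz

end ValuationSubring

/-- A point of a Noetherian domain at which the maximal ideal becomes principal is the centre of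
a unique valuation ring. -/
theorem exists_valuationSubring_of_locally_principal {F L : Type*} [Field F] [Field L]
    (A : Subring L) [IsNoetherianRing A] [IsFractionRing A L] (φ : A →+* F)
    (π : A) (hπ : φ π = 0)
    (hprin : ∀ a, φ a = 0 → ∃ u b, φ u ≠ 0 ∧ u * a = b * π) :
    ∃ O : ValuationSubring L, A ≤ O.toSubring ∧ (∀ a : A, φ a = 0 → O.valuation (a : L) < 1) ∧
      ∀ z ∈ O, ∃ a b : A, φ b ≠ 0 ∧ z * b = a := by
  let P : Ideal A := RingHom.ker φ
  have hP : P.IsPrime := RingHom.ker_isPrime φ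
  let R := (LocalSubring.ofPrime A P).toSubring
  have hloc : IsLocalization.AtPrime R P := inferInstance
  have hR : IsLocalRing R := inferInstance
  have hN : IsNoetherianRing R := IsLocalization.isNoetherianRing P.primeCompl R inferInstance
  have hfrac : IsFractionRing R L :=
    IsFractionRing.isFractionRing_of_isDomain_of_isLocalization P.primeCompl R L
  have hmk : ∀ z ∈ R, ∃ a b : A, φ b ≠ 0 ∧ z * b = a := by
    intro z hz
    obtain ⟨⟨a, b⟩, h⟩ := IsLocalization.surj P.primeCompl (⟨z, hz⟩ : R)
    exact ⟨a, b, b.2, congrArg Subtype.val h⟩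
  -- In the localization `R` at `ker φ`, the element `u` of `hprin` becomes a unit, so `π` generates
  -- the maximal ideal. A Noetherian local domain with principal maximal ideal is a valuation ring.
  have hmax : (IsLocalRing.maximalIdeal R).IsPrincipal := by
    refine ⟨algebraMap A R π, le_antisymm (fun z hz => ?_) ?_⟩
    · obtain ⟨⟨a, s⟩, h⟩ := IsLocalization.surj P.primeCompl z
      have ha : φ a = 0 := by
        have : algebraMap A R a ∈ IsLocalRing.maximalIdeal R := h ▸ Ideal.mul_mem_right _ _ hz
        exact (IsLocalization.AtPrime.to_map_mem_maximal_iff R P a).mp this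
      obtain ⟨u, b, hu, hub⟩ := hprin a ha
      have hus : IsUnit (algebraMap A R u * algebraMap A R s) := by
        rw [← map_mul]
        exact IsLocalization.map_units R (⟨u * s, P.primeCompl.mul_mem hu s.2⟩ : P.primeCompl)
      rw [← Ideal.span, ← Ideal.unit_mul_mem_iff_mem _ hus]
      have : algebraMap A R u * algebraMap A R s * z = algebraMap A R b * algebraMap A R π := by
        rw [mul_assoc, mul_comm _ z, h, ← map_mul, hub, map_mul]
      rw [this]
      exact Ideal.mul_mem_left _ _ (Ideal.mem_span_singleton_self _)
    · rw [← Ideal.span, Ideal.span_singleton_le_iff_mem]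
      exact (IsLocalization.AtPrime.to_map_mem_maximal_iff R P π).mpr hπ
  have hval : ValuationRing R :=
    ((tfae_of_isNoetherianRing_of_isLocalRing_of_isDomain R).out 4 1).mp hmax
  let O := ValuationSubring.ofSubring R fun z => by
    rcases ValuationRing.isInteger_or_isInteger R z with ⟨w, hw⟩ | ⟨w, hw⟩
    · left; rw [← hw]; exact w.2
    · right; rw [← hw]; exact w.2
  have hAR : A ≤ R := LocalSubring.le_ofPrime A P
  refine ⟨O, hAR, fun a ha => ?_, hmk⟩
  rcases eq_or_ne (a : L) 0 with h0 | h0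
  · rw [h0, map_zero]; exact zero_lt_one
  rw [← inv_inv (a : L), O.valuation_inv_lt_one_iff (inv_ne_zero h0)]
  intro hinv
  obtain ⟨c, b, hb, h⟩ := hmk _ hinv
  apply hb
  have : b = a * c := by
    apply Subtype.ext
    rw [Subring.coe_mul, ← h, mul_inv_cancel_left₀ h0]
  rw [this, map_mul, ha, zero_mul]

/-- The field `L` is generated over `F` by `x` and `y`, and all relations between them are
consequences of `f(x, y) = 0`. -/
structure IsPlaneModel {F L : Type*} [Field F] [Field L] [Algebra F L]
    (f : MvPolynomial (Fin 2) F) (x y : L) : Prop where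
  aeval_eq_zero_iff : ∀ P, MvPolynomial.aeval ![x, y] P = 0 ↔ f ∣ P
  adjoin_eq_top : IntermediateField.adjoin F {x, y} = ⊤

/-- First-order Taylor expansion: it exhibits `X - s` and `Y - t` as generators of the ideal of the
point. -/
theorem MvPolynomial.exists_eq_C_eval_add {F : Type*} [CommRing F] (s t : F)
    (P : MvPolynomial (Fin 2) F) :
    ∃ α β, P = MvPolynomial.C (MvPolynomial.eval ![s, t] P)
      + α * (MvPolynomial.X 0 - MvPolynomial.C s) + β * (MvPolynomial.X 1 - MvPolynomial.C t) := by
  induction P using MvPolynomial.induction_on with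
  | C r => exact ⟨0, 0, by simp⟩
  | add P Q hP hQ =>
    obtain ⟨α, β, h⟩ := hP
    obtain ⟨α', β', h'⟩ := hQ
    refine ⟨α + α', β + β', ?_⟩
    rw [map_add, map_add]
    linear_combination h + h'
  | mul_X P i hP =>
    obtain ⟨α, β, h⟩ := hP
    fin_cases i
    · refine ⟨α * MvPolynomial.X 0 + MvPolynomial.C (MvPolynomial.eval ![s, t] P),
        β * MvPolynomial.X 0, ?_⟩
      simp only [map_mul, MvPolynomial.eval_X, Fin.zero_eta, Matrix.cons_val_zero]
      linear_combination MvPolynomial.X 0 * h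
    · refine ⟨α * MvPolynomial.X 1,
        β * MvPolynomial.X 1 + MvPolynomial.C (MvPolynomial.eval ![s, t] P), ?_⟩
      simp only [map_mul, MvPolynomial.eval_X, Fin.mk_one, Matrix.cons_val_one,
        Matrix.cons_val_zero]
      linear_combination MvPolynomial.X 1 * h

namespace ValuationSubring

variable {F L : Type*} [Field F] [Field L] [Algebra F L] {O : ValuationSubring L}
  {x y : L} {s t : F}

theorem mem_of_valuation_sub_lt_one (hO : ∀ t : F, algebraMap F L t ∈ O)
    (hx : O.valuation (x - algebraMap F L s) < 1) : x ∈ O := by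
  rw [← sub_add_cancel x (algebraMap F L s)]
  exact O.add_mem _ _ (O.mem_of_valuation_lt_one hx) (hO s)

theorem aeval_mem (hO : ∀ t : F, algebraMap F L t ∈ O)
    (hx : x ∈ O) (hy : y ∈ O) (P : MvPolynomial (Fin 2) F) :
    MvPolynomial.aeval ![x, y] P ∈ O := by
  induction P using MvPolynomial.induction_on with
  | C r => simpa using hO r
  | add P Q hP hQ => rw [map_add]; exact O.add_mem _ _ hP hQ
  | mul_X P i hP =>
    rw [map_mul]
    refine O.mul_mem _ _ hP ?_
    fin_cases i
    · simpa using hx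
    · simpa using hy

theorem valuation_aeval_sub_lt_one (hO : ∀ t : F, algebraMap F L t ∈ O)
    (hx : O.valuation (x - algebraMap F L s) < 1) (hy : O.valuation (y - algebraMap F L t) < 1)
    (P : MvPolynomial (Fin 2) F) :
    O.valuation (MvPolynomial.aeval ![x, y] P
      - algebraMap F L (MvPolynomial.eval ![s, t] P)) < 1 := by
  obtain ⟨α, β, h⟩ := MvPolynomial.exists_eq_C_eval_add s t P
  have hmem := aeval_mem hO (mem_of_valuation_sub_lt_one hO hx) (mem_of_valuation_sub_lt_one hO hy)
  have : MvPolynomial.aeval ![x, y] P - algebraMap F L (MvPolynomial.eval ![s, t] P)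
      = MvPolynomial.aeval ![x, y] α * (x - algebraMap F L s)
        + MvPolynomial.aeval ![x, y] β * (y - algebraMap F L t) := by
    have := congrArg (MvPolynomial.aeval ![x, y]) h
    simp only [map_add, map_mul, map_sub, MvPolynomial.aeval_X, MvPolynomial.algHom_C,
      Matrix.cons_val_zero, Matrix.cons_val_one] at this
    linear_combination this
  rw [this]
  exact O.valuation.map_add_lt (O.valuation_mul_lt_one_of_mem (hmem α) hx)
    (O.valuation_mul_lt_one_of_mem (hmem β) hy)

/-- Otherwise the value of `P` would reduce to `0`, while it also reduces to the nonzero constant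
`P(s, t)`, and residues in `F` are unique. -/
theorem inv_aeval_mem (hO : ∀ t : F, algebraMap F L t ∈ O)
    (hx : O.valuation (x - algebraMap F L s) < 1) (hy : O.valuation (y - algebraMap F L t) < 1)
    {P : MvPolynomial (Fin 2) F} (hP : MvPolynomial.eval ![s, t] P ≠ 0) :
    (MvPolynomial.aeval ![x, y] P)⁻¹ ∈ O := by
  by_contra h
  have h0 : MvPolynomial.aeval ![x, y] P ≠ 0 := fun h0 => h (by rw [h0, inv_zero]; exact O.zero_mem)
  have h1 : O.valuation (MvPolynomial.aeval ![x, y] P - algebraMap F L 0) < 1 := by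
    rw [map_zero, sub_zero, ← inv_inv (MvPolynomial.aeval ![x, y] P)]
    exact (O.valuation_inv_lt_one_iff (inv_ne_zero h0)).mpr h
  exact hP (O.eq_of_valuation_algebraMap_sub_lt_one hO
    (valuation_aeval_sub_lt_one hO hx hy P) h1)

end ValuationSubring

namespace IsPlaneModel

variable {F L : Type*} [Field F] [Field L] [Algebra F L] {f : MvPolynomial (Fin 2) F} {x y : L}

theorem exists_eq_div (h : IsPlaneModel f x y) (z : L) :
    ∃ P Q : MvPolynomial (Fin 2) F,
      z = MvPolynomial.aeval ![x, y] P / MvPolynomial.aeval ![x, y] Q := by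
  have hz : z ∈ IntermediateField.adjoin F {x, y} := h.adjoin_eq_top ▸ IntermediateField.mem_top
  rw [IntermediateField.mem_adjoin_iff_div] at hz
  have hr : ({x, y} : Set L) = Set.range ![x, y] := by simp [Set.pair_comm]
  obtain ⟨a, ha, b, hb, rfl⟩ := hz
  rw [hr, Algebra.adjoin_range_eq_range_aeval] at ha hb
  obtain ⟨P, rfl⟩ := ha
  obtain ⟨Q, rfl⟩ := hb
  exact ⟨P, Q, rfl⟩

/-- The hypotheses say that, modulo `f`, both `x - s` and `y - t` are multiples of `π` up to a
function `u` invertible at the point; so `π` is a local uniformizer. -/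
theorem existsUnique_place_of_uniformizer (h : IsPlaneModel f x y) {s t : F}
    (hf : MvPolynomial.eval ![s, t] f = 0) (hx : x ≠ algebraMap F L s)
    {π u v w : MvPolynomial (Fin 2) F} (hπ : MvPolynomial.eval ![s, t] π = 0)
    (hu : MvPolynomial.eval ![s, t] u ≠ 0)
    (hv : f ∣ u * (MvPolynomial.X 0 - MvPolynomial.C s) - v * π)
    (hw : f ∣ u * (MvPolynomial.X 1 - MvPolynomial.C t) - w * π) :
    ∃! O : ValuationSubring L, O ∈ degreeOnePlaces F L ∧
      O.valuation (x - algebraMap F L s) < 1 ∧ O.valuation (y - algebraMap F L t) < 1 := by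
  let ψ : MvPolynomial (Fin 2) F →+* L := (MvPolynomial.aeval ![x, y]).toRingHom
  have hψ : ∀ P, ψ P = MvPolynomial.aeval ![x, y] P := fun _ => rfl
  have hsurj := ψ.rangeRestrict_surjective
  have hker : RingHom.ker ψ.rangeRestrict ≤ RingHom.ker (MvPolynomial.eval ![s, t]) := by
    intro P hP
    rw [RingHom.mem_ker] at hP ⊢
    have : ψ P = 0 := congrArg Subtype.val hP
    obtain ⟨Q, rfl⟩ := (h.aeval_eq_zero_iff P).mp this
    rw [map_mul, hf, zero_mul]
  let φ : ψ.range →+* F := RingHom.liftOfSurjective _ hsurj ⟨_, hker⟩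
  have hφ : ∀ P, φ (ψ.rangeRestrict P) = MvPolynomial.eval ![s, t] P := fun P =>
    RingHom.liftOfRightInverse_comp_apply _ _ _ _ P
  have hfrac : IsFractionRing ψ.range L := IsFractionRing.of_field _ _ fun z => by
    obtain ⟨P, Q, hz⟩ := h.exists_eq_div z
    exact ⟨ψ.rangeRestrict P, ψ.rangeRestrict Q, hz⟩
  obtain ⟨O, hAO, hlt, hfr⟩ := exists_valuationSubring_of_locally_principal ψ.range φ
    (ψ.rangeRestrict π) ((hφ π).trans hπ) (by
      intro a ha
      obtain ⟨P, rfl⟩ := hsurj a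
      rw [hφ] at ha
      obtain ⟨α, β, hP⟩ := MvPolynomial.exists_eq_C_eval_add s t P
      rw [ha, map_zero, zero_add] at hP
      -- Here `P = α (X - s) + β (Y - t)`, so `u P` is `(α v + β w) π` modulo `f`.
      refine ⟨ψ.rangeRestrict u, ψ.rangeRestrict (α * v + β * w), by rwa [hφ], ?_⟩
      rw [← map_mul, ← map_mul, ← sub_eq_zero, ← map_sub]
      refine Subtype.ext ((h.aeval_eq_zero_iff _).mpr ?_)
      convert dvd_add (hv.mul_left α) (hw.mul_left β) using 1
      linear_combination u * hP)
  have hF : ∀ r : F, algebraMap F L r ∈ O := fun r => hAO ⟨MvPolynomial.C r, by simp [hψ]⟩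
  have hlt' : ∀ P : MvPolynomial (Fin 2) F, MvPolynomial.eval ![s, t] P = 0 →
      O.valuation (MvPolynomial.aeval ![x, y] P) < 1 := fun P hP =>
    hlt (ψ.rangeRestrict P) ((hφ P).trans hP)
  have hfr' : ∀ z ∈ O, ∃ P Q : MvPolynomial (Fin 2) F, MvPolynomial.eval ![s, t] Q ≠ 0 ∧
      z * MvPolynomial.aeval ![x, y] Q = MvPolynomial.aeval ![x, y] P := by
    intro z hz
    obtain ⟨a, b, hb, hab⟩ := hfr z hz
    obtain ⟨P, rfl⟩ := hsurj a
    obtain ⟨Q, rfl⟩ := hsurj b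
    exact ⟨P, Q, by rwa [hφ] at hb, hab⟩
  have hOx : O.valuation (x - algebraMap F L s) < 1 := by
    have := hlt' (MvPolynomial.X 0 - MvPolynomial.C s) (by simp)
    rwa [map_sub, MvPolynomial.aeval_X, MvPolynomial.algHom_C] at this
  have hOy : O.valuation (y - algebraMap F L t) < 1 := by
    have := hlt' (MvPolynomial.X 1 - MvPolynomial.C t) (by simp)
    rwa [map_sub, MvPolynomial.aeval_X, MvPolynomial.algHom_C] at this
  have hne0 : ∀ Q : MvPolynomial (Fin 2) F, MvPolynomial.eval ![s, t] Q ≠ 0 →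
      MvPolynomial.aeval ![x, y] Q ≠ 0 := by
    intro Q hQ h0
    obtain ⟨R, rfl⟩ := (h.aeval_eq_zero_iff Q).mp h0
    rw [map_mul, hf, zero_mul] at hQ
    exact hQ rfl
  refine ⟨O, ⟨⟨?_, hF, ?_⟩, hOx, hOy⟩, ?_⟩
  · rintro rfl
    exact ValuationSubring.inv_notMem_of_valuation_lt_one _ (sub_ne_zero.mpr hx) hOx
      (ValuationSubring.mem_top _)
  · intro z hz
    obtain ⟨P, Q, hQ, hzQ⟩ := hfr' z hz
    have hQ0 := hne0 Q hQ
    refine ⟨MvPolynomial.eval ![s, t] P / MvPolynomial.eval ![s, t] Q, ?_⟩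
    have e : z - algebraMap F L (MvPolynomial.eval ![s, t] P / MvPolynomial.eval ![s, t] Q)
        = (MvPolynomial.aeval ![x, y] Q)⁻¹ * MvPolynomial.aeval ![x, y] (P - MvPolynomial.C
          (MvPolynomial.eval ![s, t] P / MvPolynomial.eval ![s, t] Q) * Q) := by
      rw [map_sub, map_mul, ← hzQ, MvPolynomial.algHom_C]
      field_simp
    rw [e]
    exact O.valuation_mul_lt_one_of_mem (ValuationSubring.inv_aeval_mem hF hOx hOy hQ)
      (hlt' _ (by simp [hQ]))
  · rintro O' ⟨⟨-, hF', -⟩, hx', hy'⟩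
    have hA' := ValuationSubring.aeval_mem hF'
      (ValuationSubring.mem_of_valuation_sub_lt_one hF' hx')
      (ValuationSubring.mem_of_valuation_sub_lt_one hF' hy')
    -- Elements of `O` are fractions `P/Q` with `Q(s, t) ≠ 0`, so any competitor `O'` contains and
    -- dominates `O`; valuation rings are maximal for domination.
    symm
    refine ValuationSubring.eq_of_le_of_forall_valuation_lt_one (fun z hz => ?_) (fun z hz => ?_)
    · obtain ⟨P, Q, hQ, hzQ⟩ := hfr' z hz
      rw [← eq_mul_inv_iff_mul_eq₀ (hne0 Q hQ)] at hzQ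
      rw [hzQ]
      exact O'.mul_mem _ _ (hA' P) (ValuationSubring.inv_aeval_mem hF' hx' hy' hQ)
    · obtain ⟨P, Q, hQ, hzQ⟩ := hfr' z (O.mem_of_valuation_lt_one hz)
      have hP : MvPolynomial.eval ![s, t] P = 0 := by
        by_contra hP
        rcases eq_or_ne z 0 with rfl | hz0
        · exact hne0 P hP (by rw [← hzQ, zero_mul])
        refine O.inv_notMem_of_valuation_lt_one hz0 hz ?_
        have e : z⁻¹ = MvPolynomial.aeval ![x, y] Q * (MvPolynomial.aeval ![x, y] P)⁻¹ := by
          have := hne0 Q hQ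
          rw [← hzQ]
          field_simp
        rw [e]
        exact O.mul_mem _ _ (hAO ⟨Q, rfl⟩) (ValuationSubring.inv_aeval_mem hF hOx hOy hP)
      have hv' := ValuationSubring.valuation_aeval_sub_lt_one hF' hx' hy' P
      rw [hP, map_zero, sub_zero] at hv'
      rw [← eq_mul_inv_iff_mul_eq₀ (hne0 Q hQ), mul_comm] at hzQ
      rw [hzQ]
      exact O'.valuation_mul_lt_one_of_mem (ValuationSubring.inv_aeval_mem hF' hx' hy' hQ) hv'

end IsPlaneModel

/-! ### Function fields of the family and the inversion `x ↦ 1/x` -/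

section Relations

variable {F L : Type*} [Field F] [Field L] [Algebra F L]

theorem aeval_genFermatAffine (a b c : F) (n : ℕ) (x y : L) :
    MvPolynomial.aeval ![x, y] (genFermatAffine a b c n n)
      = algebraMap F L a * x ^ n * y ^ n + algebraMap F L b * x ^ n
        + algebraMap F L c * y ^ n - 1 := by
  simp [genFermatAffine, MvPolynomial.algHom_C]

theorem eval_genFermatAffine (a b c : F) (n : ℕ) (s t : F) :
    MvPolynomial.eval ![s, t] (genFermatAffine a b c n n)
      = a * s ^ n * t ^ n + b * s ^ n + c * t ^ n - 1 := by
  simp [genFermatAffine]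

/-- Dividing the equation by `-b x^n` gives an equation of the same shape in `1/x` and `y`. Hence
the results on affine points also apply at the poles of `x`. -/
theorem aeval_inv_genFermatAffine (a : F) {b : F} (c : F) (hb : b ≠ 0) (n : ℕ) {x : L}
    (hx : x ≠ 0) (y : L) :
    MvPolynomial.aeval ![x⁻¹, y] (genFermatAffine (-c / b) b⁻¹ (-a / b) n n)
      = -((algebraMap F L b)⁻¹ * (x ^ n)⁻¹)
        * MvPolynomial.aeval ![x, y] (genFermatAffine a b c n n) := by
  have hb' : algebraMap F L b ≠ 0 := by simpa using hb
  rw [aeval_genFermatAffine, aeval_genFermatAffine]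
  simp only [map_div₀, map_neg, map_inv₀, inv_pow]
  field_simp
  ring

theorem ValuationSubring.eval_eq_zero_of_aeval_eq_zero {O : ValuationSubring L}
    (hO : ∀ t : F, algebraMap F L t ∈ O) {x y : L} {s t : F}
    (hx : O.valuation (x - algebraMap F L s) < 1) (hy : O.valuation (y - algebraMap F L t) < 1)
    {P : MvPolynomial (Fin 2) F} (hP : MvPolynomial.aeval ![x, y] P = 0) :
    MvPolynomial.eval ![s, t] P = 0 := by
  have h := ValuationSubring.valuation_aeval_sub_lt_one hO hx hy P
  rw [hP] at h
  refine (O.eq_of_valuation_algebraMap_sub_lt_one hO (x := (0 : L)) (s := 0) ?_ h).symm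
  simp

end Relations

/-- Clears denominators in `P(1/x, y)`. A single `Q` must serve all fields `K`, since
`IsPlaneModel.inv` evaluates it in two different function fields; this forces the common universe.
-/
theorem MvPolynomial.exists_aeval_eq_pow_mul_aeval_inv {F : Type u} [Field F]
    (P : MvPolynomial (Fin 2) F) :
    ∃ (N : ℕ) (Q : MvPolynomial (Fin 2) F), ∀ {K : Type u} [Field K] [Algebra F K] (x y : K),
      x ≠ 0 → MvPolynomial.aeval ![x, y] Q = x ^ N * MvPolynomial.aeval ![x⁻¹, y] P := by
  induction P using MvPolynomial.induction_on with
  | C r => exact ⟨0, MvPolynomial.C r, fun x y _ => by simp⟩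
  | add P P' hP hP' =>
    obtain ⟨N, Q, h⟩ := hP
    obtain ⟨N', Q', h'⟩ := hP'
    refine ⟨N + N', MvPolynomial.X 0 ^ N' * Q + MvPolynomial.X 0 ^ N * Q', fun x y hx => ?_⟩
    simp only [map_add, map_mul, map_pow, MvPolynomial.aeval_X, h x y hx, h' x y hx,
      Matrix.cons_val_zero]
    ring
  | mul_X P i hP =>
    obtain ⟨N, Q, h⟩ := hP
    fin_cases i
    · refine ⟨N + 1, Q, fun x y hx => ?_⟩
      simp only [map_mul, MvPolynomial.aeval_X, h x y hx, Fin.zero_eta, Matrix.cons_val_zero]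
      rw [pow_succ, mul_assoc, mul_comm _ x⁻¹, mul_inv_cancel_left₀ hx]
    · refine ⟨N, Q * MvPolynomial.X 1, fun x y hx => ?_⟩
      simp only [map_mul, MvPolynomial.aeval_X, h x y hx, Fin.mk_one, Matrix.cons_val_one,
        Matrix.cons_val_zero]
      ring

theorem isPlaneModel_curveCoordinates {F : Type*} [Field F] (f : MvPolynomial (Fin 2) F)
    [GeomIrreducible f] : IsPlaneModel f (curveCoordinates f 0) (curveCoordinates f 1) := by
  have key : ∀ P : MvPolynomial (Fin 2) F,
      MvPolynomial.aeval ![curveCoordinates f 0, curveCoordinates f 1] P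
      = algebraMap (CurveCoordinateRing f) (CurveFunctionField f) (Ideal.Quotient.mk _ P) := by
    intro P
    induction P using MvPolynomial.induction_on with
    | C r =>
      rw [MvPolynomial.algHom_C, IsScalarTower.algebraMap_apply F (CurveCoordinateRing f)]
      rfl
    | add P Q hP hQ => rw [map_add, map_add, map_add, hP, hQ]
    | mul_X P i hP =>
      rw [map_mul, map_mul, map_mul, hP, MvPolynomial.aeval_X]
      fin_cases i <;> rfl
  refine ⟨fun P => ?_, ?_⟩
  · rw [key, map_eq_zero_iff _ (IsFractionRing.injective _ _), Ideal.Quotient.eq_zero_iff_mem,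
      Ideal.mem_span_singleton]
  · have hmem : ∀ P : MvPolynomial (Fin 2) F,
        MvPolynomial.aeval ![curveCoordinates f 0, curveCoordinates f 1] P ∈
        IntermediateField.adjoin F {curveCoordinates f 0, curveCoordinates f 1} := by
      intro P
      induction P using MvPolynomial.induction_on with
      | C r => rw [MvPolynomial.algHom_C]; exact IntermediateField.algebraMap_mem _ _
      | add P Q hP hQ => rw [map_add]; exact add_mem hP hQ
      | mul_X P i hP =>
        rw [map_mul, MvPolynomial.aeval_X]
        refine mul_mem hP (IntermediateField.subset_adjoin _ _ ?_)
        fin_cases i <;> simp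
    rw [eq_top_iff]
    intro z _
    obtain ⟨A, B, -, rfl⟩ := IsFractionRing.div_surjective (A := CurveCoordinateRing f) z
    obtain ⟨P, rfl⟩ := Ideal.Quotient.mk_surjective A
    obtain ⟨Q, rfl⟩ := Ideal.Quotient.mk_surjective B
    rw [← key, ← key]
    exact div_mem (hmem P) (hmem Q)

namespace IsPlaneModel

section

variable {F L : Type*} [Field F] [Field L] [Algebra F L] {a b c : F} {n : ℕ} {x y : L}

theorem relation (h : IsPlaneModel (genFermatAffine a b c n n) x y) :
    algebraMap F L a * x ^ n * y ^ n + algebraMap F L b * x ^ n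
        + algebraMap F L c * y ^ n - 1 = 0 := by
  rw [← aeval_genFermatAffine]
  exact (h.aeval_eq_zero_iff _).mpr dvd_rfl

theorem swap (h : IsPlaneModel (genFermatAffine a b c n n) x y) :
    IsPlaneModel (genFermatAffine a c b n n) y x := by
  let e : MvPolynomial (Fin 2) F ≃ₐ[F] MvPolynomial (Fin 2) F :=
    MvPolynomial.renameEquiv F (Equiv.swap 0 1)
  have hvec : ![x, y] ∘ Equiv.swap (0 : Fin 2) 1 = ![y, x] := by
    ext i; fin_cases i <;> simp
  have he : e (genFermatAffine a c b n n) = genFermatAffine a b c n n := by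
    simp [e, genFermatAffine]
    ring
  refine ⟨fun P => ?_, by rw [Set.pair_comm]; exact h.adjoin_eq_top⟩
  have h1 : MvPolynomial.aeval ![x, y] (e P) = MvPolynomial.aeval ![y, x] P := by
    rw [← hvec]; exact MvPolynomial.aeval_rename _ _ _
  rw [← h1, h.aeval_eq_zero_iff, ← he, map_dvd_iff]

/-- Otherwise `f` divides `X - s`, and setting `y = 0` makes `b X^n - 1`, of degree at least `2`,
divide a linear polynomial. -/
theorem fst_ne_algebraMap (h : IsPlaneModel (genFermatAffine a b c n n) x y) (hb : b ≠ 0)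
    (hn : 2 ≤ n) (s : F) : x ≠ algebraMap F L s := by
  rintro hx
  have hdvd : genFermatAffine a b c n n ∣ MvPolynomial.X 0 - MvPolynomial.C s := by
    rw [← h.aeval_eq_zero_iff, map_sub, MvPolynomial.aeval_X, MvPolynomial.algHom_C]
    simp [hx]
  have h2 := map_dvd (MvPolynomial.aeval ![(Polynomial.X : Polynomial F), 0]) hdvd
  have hn0 : n ≠ 0 := by omega
  have e1 : MvPolynomial.aeval ![(Polynomial.X : Polynomial F), 0] (genFermatAffine a b c n n)
      = Polynomial.C b * Polynomial.X ^ n - Polynomial.C 1 := by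
    simp [genFermatAffine, hn0, MvPolynomial.algHom_C, Polynomial.algebraMap_eq]
  have e2 : MvPolynomial.aeval ![(Polynomial.X : Polynomial F), 0]
      (MvPolynomial.X 0 - MvPolynomial.C s : MvPolynomial (Fin 2) F)
      = Polynomial.X - Polynomial.C s := by
    rw [map_sub, MvPolynomial.aeval_X, MvPolynomial.algHom_C]
    simp [Polynomial.algebraMap_eq]
  rw [e1, e2] at h2
  have h3 := Polynomial.natDegree_le_of_dvd h2 (Polynomial.X_sub_C_ne_zero s)
  rw [Polynomial.natDegree_sub_C, Polynomial.natDegree_C_mul_X_pow n b hb,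
    Polynomial.natDegree_X_sub_C] at h3
  omega

/-- The uniformizer is `x - s`, because `f(x, y) - f(s, t) = (a x^n + c)(y^n - t^n) + (a t^n +
b)(x^n - s^n)`. Factoring out `y - t` and `x - s` gives `u` and `w`, with `u(s, t) = (a s^n + c) n
t^(n-1) ≠ 0`. -/
theorem existsUnique_place_of_snd_ne_zero (h : IsPlaneModel (genFermatAffine a b c n n) x y)
    (hb : b ≠ 0) (habc : a + b * c ≠ 0) (hn : (n : F) ≠ 0) (hn2 : 2 ≤ n)
    {s t : F} (hst : a * s ^ n * t ^ n + b * s ^ n + c * t ^ n - 1 = 0) (ht : t ≠ 0) :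
    ∃! O : ValuationSubring L, O ∈ degreeOnePlaces F L ∧
      O.valuation (x - algebraMap F L s) < 1 ∧ O.valuation (y - algebraMap F L t) < 1 := by
  have hu : a * s ^ n + c ≠ 0 := by
    intro h0
    apply habc
    linear_combination -a * hst + (b + a * t ^ n) * h0
  let u : MvPolynomial (Fin 2) F :=
    (MvPolynomial.C a * MvPolynomial.X 0 ^ n + MvPolynomial.C c) *
      ∑ i ∈ Finset.range n, MvPolynomial.X 1 ^ i * MvPolynomial.C t ^ (n - 1 - i)
  let w : MvPolynomial (Fin 2) F :=
    -(MvPolynomial.C a * MvPolynomial.C t ^ n + MvPolynomial.C b) *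
      ∑ i ∈ Finset.range n, MvPolynomial.X 0 ^ i * MvPolynomial.C s ^ (n - 1 - i)
  refine h.existsUnique_place_of_uniformizer (π := MvPolynomial.X 0 - MvPolynomial.C s)
    (u := u) (v := u) (w := w) ?_ (h.fst_ne_algebraMap hb hn2 s) (by simp) ?_ (by simp) ?_
  · rw [eval_genFermatAffine, hst]
  · simp only [u, map_mul, map_add, map_sum, map_pow, MvPolynomial.eval_C, MvPolynomial.eval_X,
      Matrix.cons_val_zero, Matrix.cons_val_one, geom_sum₂_self]
    exact mul_ne_zero hu (mul_ne_zero hn (pow_ne_zero _ ht))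
  · have h1 := geom_sum₂_mul (MvPolynomial.X 1 : MvPolynomial (Fin 2) F) (MvPolynomial.C t) n
    have h2 := geom_sum₂_mul (MvPolynomial.X 0 : MvPolynomial (Fin 2) F) (MvPolynomial.C s) n
    have h3 := congrArg (MvPolynomial.C : F → MvPolynomial (Fin 2) F) hst
    simp only [map_add, map_sub, map_mul, map_pow, map_one, map_zero] at h3
    have : u * (MvPolynomial.X 1 - MvPolynomial.C t) - w * (MvPolynomial.X 0 - MvPolynomial.C s)
        = genFermatAffine a b c n n := by
      simp only [u, w, genFermatAffine]
      linear_combination (MvPolynomial.C a * MvPolynomial.X 0 ^ n + MvPolynomial.C c) * h1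
        + (MvPolynomial.C a * MvPolynomial.C t ^ n + MvPolynomial.C b) * h2 - h3
    rw [this]

theorem existsUnique_place (h : IsPlaneModel (genFermatAffine a b c n n) x y)
    (hb : b ≠ 0) (hc : c ≠ 0) (habc : a + b * c ≠ 0) (hn : (n : F) ≠ 0) (hn2 : 2 ≤ n)
    {s t : F} (hst : a * s ^ n * t ^ n + b * s ^ n + c * t ^ n - 1 = 0) :
    ∃! O : ValuationSubring L, O ∈ degreeOnePlaces F L ∧
      O.valuation (x - algebraMap F L s) < 1 ∧ O.valuation (y - algebraMap F L t) < 1 := by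
  have hn0 : n ≠ 0 := by omega
  -- A point with `t = 0` has `s ≠ 0`, so exchanging the variables applies and `y` becomes the
  -- uniformizer.
  rcases eq_or_ne t 0 with rfl | ht
  · have hs : s ≠ 0 := by
      rintro rfl
      simp [hn0] at hst
    have := h.swap.existsUnique_place_of_snd_ne_zero hc (by rwa [mul_comm c b]) hn hn2
      (s := 0) (t := s) (by linear_combination hst) hs
    exact (existsUnique_congr fun O => and_congr_right fun _ => and_comm).mp this
  · exact h.existsUnique_place_of_snd_ne_zero hb habc hn hn2 hst ht

end

/-- The hard direction is that a relation `P(1/x, y) = 0` comes from the inverted equation. Clearing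
denominators gives `Q` divisible by `f`. At a generic point `(s, t)` of the inverted curve, `f(1/s,
t) = 0`, so `Q(1/s, t) = 0` and therefore `P(s, t) = 0`, which is the required divisibility. -/
theorem inv {F L : Type u} [Field F] [Field L] [Algebra F L] {a b c : F} {n : ℕ} {x y : L}
    (h : IsPlaneModel (genFermatAffine a b c n n) x y) (ha : a ≠ 0) (hb : b ≠ 0)
    (habc : a + b * c ≠ 0) (hn : (n : F) ≠ 0) (hn2 : 2 ≤ n) :
    IsPlaneModel (genFermatAffine (-c / b) b⁻¹ (-a / b) n n) x⁻¹ y := by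
  have hx : x ≠ 0 := by simpa using h.fst_ne_algebraMap hb hn2 0
  have hg : GeomIrreducible (genFermatAffine (-c / b) b⁻¹ (-a / b) n n) := by
    refine geomIrreducible_genFermatAffine (div_ne_zero (neg_ne_zero.mpr ha) hb) ?_ hn
    intro h0
    apply habc
    field_simp at h0
    linear_combination -h0
  refine ⟨fun P => ⟨fun hP => ?_, ?_⟩, ?_⟩
  · obtain ⟨N, Q, hQ⟩ := P.exists_aeval_eq_pow_mul_aeval_inv
    have hQ0 := hQ x y hx
    rw [hP, mul_zero, h.aeval_eq_zero_iff] at hQ0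
    obtain ⟨R, rfl⟩ := hQ0
    have h' := isPlaneModel_curveCoordinates (genFermatAffine (-c / b) b⁻¹ (-a / b) n n)
    generalize curveCoordinates (genFermatAffine (-c / b) b⁻¹ (-a / b) n n) 0 = s,
      curveCoordinates (genFermatAffine (-c / b) b⁻¹ (-a / b) n n) 1 = t at h'
    have hs : s ≠ 0 := by simpa using h'.fst_ne_algebraMap (inv_ne_zero hb) hn2 0
    have hb' : algebraMap F (CurveFunctionField (genFermatAffine (-c / b) b⁻¹ (-a / b) n n)) b ≠ 0 :=
      by simpa using hb
    have h1 := aeval_inv_genFermatAffine a c hb n (inv_ne_zero hs) t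
    rw [inv_inv, (h'.aeval_eq_zero_iff _).mpr dvd_rfl, eq_comm, mul_eq_zero,
      or_iff_right (by simp [hs, hb'])] at h1
    have h2 := hQ s⁻¹ t (inv_ne_zero hs)
    rw [map_mul, h1, zero_mul, inv_inv, eq_comm, mul_eq_zero, or_iff_right (by simp [hs])] at h2
    exact (h'.aeval_eq_zero_iff P).mp h2
  · rintro ⟨R, rfl⟩
    rw [map_mul, aeval_inv_genFermatAffine a c hb n hx, (h.aeval_eq_zero_iff _).mpr dvd_rfl,
      mul_zero, zero_mul]
  · rw [eq_top_iff, ← h.adjoin_eq_top, IntermediateField.adjoin_le_iff]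
    rintro z (rfl | rfl)
    · rw [← inv_inv z]
      exact inv_mem (IntermediateField.subset_adjoin _ _ (by simp))
    · exact IntermediateField.subset_adjoin _ _ (by simp)

end IsPlaneModel

/-! ### Counting the places of degree one -/

/-- The degree-one places at which the pair `(x, y)` takes a value in `T`. -/
def placesOver {F L : Type*} [Field F] [Field L] [Algebra F L] (x y : L) (T : Set (F × F)) :
    Set (ValuationSubring L) :=
  {O | O ∈ degreeOnePlaces F L ∧ ∃ P ∈ T,
    O.valuation (x - algebraMap F L P.1) < 1 ∧ O.valuation (y - algebraMap F L P.2) < 1}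

theorem exists_algebraMap_of_mem_degreeOnePlaces {F L : Type*} [Field F] [Field L] [Algebra F L]
    {O : ValuationSubring L} (hO : O ∈ degreeOnePlaces F L) {x : L} (hx : x ∈ O) :
    ∃ s : F, O.valuation (x - algebraMap F L s) < 1 := hO.2.2 x hx

theorem ValuationSubring.valuation_inv_sub_zero_lt_one_iff {F L : Type*} [Field F] [Field L]
    [Algebra F L] {O : ValuationSubring L} {x : L} (hx : x ≠ 0) :
    O.valuation (x⁻¹ - algebraMap F L 0) < 1 ↔ x ∉ O := by
  rw [map_zero, sub_zero, O.valuation_inv_lt_one_iff hx]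

theorem ncard_setOf_fst_eq_zero_and {F : Type*} [Zero F] (p : F → Prop) :
    {P : F × F | P.1 = 0 ∧ p P.2}.ncard = {t | p t}.ncard := by
  have : {P : F × F | P.1 = 0 ∧ p P.2} = Prod.mk 0 '' {t | p t} := by
    ext ⟨s, t⟩
    simp [and_comm, eq_comm]
  rw [this, Set.ncard_image_of_injective _ (Prod.mk_right_injective 0)]

namespace IsPlaneModel

section

variable {F L : Type*} [Field F] [Field L] [Algebra F L] {a b c : F} {n : ℕ} {x y : L}

theorem finite_placesOver_and_ncard (h : IsPlaneModel (genFermatAffine a b c n n) x y)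
    (hb : b ≠ 0) (hc : c ≠ 0) (habc : a + b * c ≠ 0) (hn : (n : F) ≠ 0) (hn2 : 2 ≤ n) [Finite F]
    {T : Set (F × F)} (hT : T ⊆ genFermatPoints a b c n) :
    (placesOver x y T).Finite ∧ (placesOver x y T).ncard = T.ncard := by
  have hex : ∀ P : F × F, ∃ O : ValuationSubring L, P ∈ T → (O ∈ degreeOnePlaces F L ∧
      O.valuation (x - algebraMap F L P.1) < 1 ∧ O.valuation (y - algebraMap F L P.2) < 1) := by
    intro P
    by_cases hP : P ∈ T
    · obtain ⟨O, hO, -⟩ := h.existsUnique_place hb hc habc hn hn2 (hT hP)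
      exact ⟨O, fun _ => hO⟩
    -- A dummy value outside `T`; only the restriction of `g` to `T` matters.
    · exact ⟨⊤, fun hP' => absurd hP' hP⟩
  choose g hg using hex
  have himage : placesOver x y T = g '' T := by
    ext O
    constructor
    · rintro ⟨hO, P, hP, hOP⟩
      exact ⟨P, hP, (h.existsUnique_place hb hc habc hn hn2 (hT hP)).unique (hg P hP) ⟨hO, hOP⟩⟩
    · rintro ⟨P, hP, rfl⟩
      exact ⟨(hg P hP).1, P, hP, (hg P hP).2⟩
  have hinj : Set.InjOn g T := by
    intro P hP P' hP' hPP'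
    obtain ⟨hO, h1, h2⟩ := hg P hP
    obtain ⟨-, h1', h2'⟩ := hg P' hP'
    rw [← hPP'] at h1' h2'
    exact Prod.ext (ValuationSubring.eq_of_valuation_algebraMap_sub_lt_one _ hO.2.1 h1 h1')
      (ValuationSubring.eq_of_valuation_algebraMap_sub_lt_one _ hO.2.1 h2 h2')
  rw [himage]
  exact ⟨(Set.toFinite T).image g, hinj.ncard_image⟩

theorem ne_zero_fst (h : IsPlaneModel (genFermatAffine a b c n n) x y) (hb : b ≠ 0)
    (hn2 : 2 ≤ n) : x ≠ 0 := by simpa using h.fst_ne_algebraMap hb hn2 0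

/-- Divided by `x^n y^n`, the equation reads `a + b y^(-n) + c x^(-n) = x^(-n) y^(-n)`; at a common
pole of `x` and `y` it would reduce to `a = 0`. -/
theorem snd_mem_of_fst_notMem (h : IsPlaneModel (genFermatAffine a b c n n) x y) (ha : a ≠ 0)
    (hb : b ≠ 0) (hc : c ≠ 0) (hn2 : 2 ≤ n) {O : ValuationSubring L}
    (hO : O ∈ degreeOnePlaces F L) (hx : x ∉ O) : y ∈ O := by
  by_contra hy
  have hx0 := h.ne_zero_fst hb hn2
  have hy0 := h.swap.ne_zero_fst hc hn2
  have hn0 : n ≠ 0 := by omega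
  have hrel : MvPolynomial.aeval ![x⁻¹, y⁻¹] (MvPolynomial.C a + MvPolynomial.C b
      * MvPolynomial.X 1 ^ n + MvPolynomial.C c * MvPolynomial.X 0 ^ n
      - MvPolynomial.X 0 ^ n * MvPolynomial.X 1 ^ n) = 0 := by
    have := h.relation
    simp only [map_add, map_sub, map_mul, map_pow, MvPolynomial.algHom_C, MvPolynomial.aeval_X,
      Matrix.cons_val_zero, Matrix.cons_val_one, inv_pow]
    field_simp
    linear_combination this
  have := ValuationSubring.eval_eq_zero_of_aeval_eq_zero hO.2.1
    ((ValuationSubring.valuation_inv_sub_zero_lt_one_iff hx0).mpr hx)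
    ((ValuationSubring.valuation_inv_sub_zero_lt_one_iff hy0).mpr hy) hrel
  simp [hn0] at this
  exact ha this

theorem mem_placesOver_genFermatPoints_iff (h : IsPlaneModel (genFermatAffine a b c n n) x y)
    {O : ValuationSubring L} (hO : O ∈ degreeOnePlaces F L) :
    O ∈ placesOver x y (genFermatPoints a b c n) ↔ x ∈ O ∧ y ∈ O := by
  constructor
  · rintro ⟨-, P, -, h1, h2⟩
    exact ⟨ValuationSubring.mem_of_valuation_sub_lt_one hO.2.1 h1,
      ValuationSubring.mem_of_valuation_sub_lt_one hO.2.1 h2⟩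
  · rintro ⟨hx, hy⟩
    obtain ⟨s, hs⟩ := exists_algebraMap_of_mem_degreeOnePlaces hO hx
    obtain ⟨t, ht⟩ := exists_algebraMap_of_mem_degreeOnePlaces hO hy
    refine ⟨hO, (s, t), ?_, hs, ht⟩
    have := ValuationSubring.eval_eq_zero_of_aeval_eq_zero hO.2.1 hs ht
      ((h.aeval_eq_zero_iff _).mpr dvd_rfl)
    rwa [eval_genFermatAffine] at this

end

variable {F L : Type u} [Field F] [Field L] [Algebra F L] {a b c : F} {n : ℕ} {x y : L}

/-- At a pole of `x` the pair `(1/x, y)` reduces to some `(0, t)`, and the inverted equation there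
is `(-a/b) t^n = 1`. -/
theorem mem_placesOver_inv_iff (h : IsPlaneModel (genFermatAffine a b c n n) x y) (ha : a ≠ 0)
    (hb : b ≠ 0) (hc : c ≠ 0) (habc : a + b * c ≠ 0) (hn : (n : F) ≠ 0) (hn2 : 2 ≤ n)
    {O : ValuationSubring L} (hO : O ∈ degreeOnePlaces F L) :
    O ∈ placesOver x⁻¹ y {P : F × F | P.1 = 0 ∧ P.2 ^ n = -b / a} ↔ x ∉ O := by
  have hx0 := h.ne_zero_fst hb hn2
  have hn0 : n ≠ 0 := by omega
  constructor
  · rintro ⟨-, P, ⟨hP, -⟩, h1, -⟩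
    rw [hP] at h1
    exact (ValuationSubring.valuation_inv_sub_zero_lt_one_iff hx0).mp h1
  · intro hx
    have hx' := (ValuationSubring.valuation_inv_sub_zero_lt_one_iff (F := F) hx0).mpr hx
    obtain ⟨t, ht⟩ := exists_algebraMap_of_mem_degreeOnePlaces hO
      (h.snd_mem_of_fst_notMem ha hb hc hn2 hO hx)
    refine ⟨hO, (0, t), ⟨rfl, ?_⟩, hx', ht⟩
    have := ValuationSubring.eval_eq_zero_of_aeval_eq_zero hO.2.1 hx' ht
      (((h.inv ha hb habc hn hn2).aeval_eq_zero_iff _).mpr dvd_rfl)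
    rw [eval_genFermatAffine, zero_pow hn0] at this
    field_simp at this ⊢
    linear_combination -this

theorem finite_placesOver_inv_and_ncard (h : IsPlaneModel (genFermatAffine a b c n n) x y)
    (ha : a ≠ 0) (hb : b ≠ 0) (habc : a + b * c ≠ 0) (hn : (n : F) ≠ 0) (hn2 : 2 ≤ n)
    [Finite F] (hroots : {t : F | t ^ n = -b / a}.ncard = n) :
    (placesOver x⁻¹ y {P : F × F | P.1 = 0 ∧ P.2 ^ n = -b / a}).Finite ∧
      (placesOver x⁻¹ y {P : F × F | P.1 = 0 ∧ P.2 ^ n = -b / a}).ncard = n := by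
  have hn0 : n ≠ 0 := by omega
  have key := (h.inv ha hb habc hn hn2).finite_placesOver_and_ncard (inv_ne_zero hb)
    (div_ne_zero (neg_ne_zero.mpr ha) hb) (by
      intro h0
      apply habc
      field_simp at h0
      linear_combination -h0) hn hn2 (T := {P : F × F | P.1 = 0 ∧ P.2 ^ n = -b / a}) (by
      rintro ⟨s, t⟩ ⟨hs, ht⟩
      simp only at hs ht
      simp only [genFermatPoints, Set.mem_ofPred_eq, hs, ht, zero_pow hn0]
      field_simp
      ring)
  rwa [ncard_setOf_fst_eq_zero_and fun t : F => t ^ n = -b / a, hroots] at key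

theorem degreeOnePlaces_eq (h : IsPlaneModel (genFermatAffine a b c n n) x y) (ha : a ≠ 0)
    (hb : b ≠ 0) (hc : c ≠ 0) (habc : a + b * c ≠ 0) (hn : (n : F) ≠ 0) (hn2 : 2 ≤ n) :
    degreeOnePlaces F L = placesOver x y (genFermatPoints a b c n)
      ∪ placesOver x⁻¹ y {P : F × F | P.1 = 0 ∧ P.2 ^ n = -b / a}
      ∪ placesOver y⁻¹ x {P : F × F | P.1 = 0 ∧ P.2 ^ n = -c / a} := by
  ext O
  constructor
  · intro hO
    by_cases hx : x ∈ O
    · by_cases hy : y ∈ O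
      · exact Or.inl (Or.inl ((h.mem_placesOver_genFermatPoints_iff hO).mpr ⟨hx, hy⟩))
      · exact Or.inr ((h.swap.mem_placesOver_inv_iff ha hc hb (by rwa [mul_comm c b]) hn hn2 hO).mpr
          hy)
    · exact Or.inl (Or.inr ((h.mem_placesOver_inv_iff ha hb hc habc hn hn2 hO).mpr hx))
  · rintro ((hO | hO) | hO) <;> exact hO.1

theorem ncard_degreeOnePlaces (h : IsPlaneModel (genFermatAffine a b c n n) x y) (ha : a ≠ 0)
    (hb : b ≠ 0) (hc : c ≠ 0) (habc : a + b * c ≠ 0) (hn : (n : F) ≠ 0) (hn2 : 2 ≤ n)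
    [Finite F] (hroots : {t : F | t ^ n = -b / a}.ncard = n)
    (hroots' : {t : F | t ^ n = -c / a}.ncard = n) :
    (degreeOnePlaces F L).ncard = (genFermatPoints a b c n).ncard + n + n := by
  have habc' : a + c * b ≠ 0 := by rwa [mul_comm c b]
  obtain ⟨f0, c0⟩ := h.finite_placesOver_and_ncard hb hc habc hn hn2 subset_rfl
  obtain ⟨f1, c1⟩ := h.finite_placesOver_inv_and_ncard ha hb habc hn hn2 hroots
  obtain ⟨f2, c2⟩ := h.swap.finite_placesOver_inv_and_ncard ha hc habc' hn hn2 hroots'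
  rw [h.degreeOnePlaces_eq ha hb hc habc hn hn2, Set.ncard_union_eq ?_ (f0.union f1) f2,
    Set.ncard_union_eq ?_ f0 f1, c0, c1, c2]
  · rw [Set.disjoint_left]
    intro O h0 h1
    exact (h.mem_placesOver_inv_iff ha hb hc habc hn hn2 h0.1).mp h1
      ((h.mem_placesOver_genFermatPoints_iff h0.1).mp h0).1
  · rw [Set.disjoint_left]
    intro O h0 h2
    have hy := (h.swap.mem_placesOver_inv_iff ha hc hb habc' hn hn2 h2.1).mp h2
    rcases h0 with h0 | h0
    · exact hy ((h.mem_placesOver_genFermatPoints_iff h0.1).mp h0).2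
    · exact hy (h.snd_mem_of_fst_notMem ha hb hc hn2 h0.1
        ((h.mem_placesOver_inv_iff ha hb hc habc hn hn2 h0.1).mp h0))

end IsPlaneModel

/-! ### Branches centred at the two singular points -/

section BranchesAtInfinity

variable {F : Type u} [Field F] {a b c : F} {n : ℕ} [GeomIrreducible (genFermatAffine a b c n n)]

theorem rationalBranchesAt_fst_eq (ha : a ≠ 0) (hb : b ≠ 0) (hc : c ≠ 0)
    (habc : a + b * c ≠ 0) (hn : (n : F) ≠ 0) (hn2 : 2 ≤ n) :
    rationalBranchesAt (genFermatAffine a b c n n) ![1, 0, 0]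
      = placesOver (curveCoordinates (genFermatAffine a b c n n) 0)⁻¹
          (curveCoordinates (genFermatAffine a b c n n) 1)
          {P : F × F | P.1 = 0 ∧ P.2 ^ n = -b / a} := by
  have h := isPlaneModel_curveCoordinates (genFermatAffine a b c n n)
  have h2 : curveCoordinates (genFermatAffine a b c n n) 2 = 1 := rfl
  have hx0 := h.ne_zero_fst hb hn2
  ext O
  constructor
  · rintro ⟨hO, i, hi, hj⟩
    refine (h.mem_placesOver_inv_iff ha hb hc habc hn hn2 hO).mpr ?_
    have hi0 : i = 0 := by
      fin_cases i
      · rfl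
      · simp at hi
      · simp at hi
    subst hi0
    rw [← O.valuation_inv_lt_one_iff hx0]
    simpa [h2] using hj 2
  · intro hO
    have hx := (h.mem_placesOver_inv_iff ha hb hc habc hn hn2 hO.1).mp hO
    -- As `y` is finite at a pole of `x`, both `y/x` and `1/x` reduce to `0`, so the centre is
    -- `(1:0:0)`.
    have hy := h.snd_mem_of_fst_notMem ha hb hc hn2 hO.1 hx
    have hx' := (O.valuation_inv_lt_one_iff hx0).mpr hx
    refine ⟨hO.1, 0, by simp, fun j => ?_⟩
    fin_cases j
    · simp [div_self hx0]
    · simpa [div_eq_mul_inv] using O.valuation_mul_lt_one_of_mem hy hx'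
    · simpa [h2] using hx'

theorem rationalBranchesAt_snd_eq (ha : a ≠ 0) (hb : b ≠ 0) (hc : c ≠ 0)
    (habc : a + b * c ≠ 0) (hn : (n : F) ≠ 0) (hn2 : 2 ≤ n) :
    rationalBranchesAt (genFermatAffine a b c n n) ![0, 1, 0]
      = placesOver (curveCoordinates (genFermatAffine a b c n n) 1)⁻¹
          (curveCoordinates (genFermatAffine a b c n n) 0)
          {P : F × F | P.1 = 0 ∧ P.2 ^ n = -c / a} := by
  have h := (isPlaneModel_curveCoordinates (genFermatAffine a b c n n)).swap
  have h2 : curveCoordinates (genFermatAffine a b c n n) 2 = 1 := rfl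
  have hx0 := h.ne_zero_fst hc hn2
  have habc' : a + c * b ≠ 0 := by rwa [mul_comm c b]
  ext O
  constructor
  · rintro ⟨hO, i, hi, hj⟩
    refine (h.mem_placesOver_inv_iff ha hc hb habc' hn hn2 hO).mpr ?_
    have hi0 : i = 1 := by
      fin_cases i
      · simp at hi
      · rfl
      · simp at hi
    subst hi0
    rw [← O.valuation_inv_lt_one_iff hx0]
    simpa [h2] using hj 2
  · intro hO
    have hx := (h.mem_placesOver_inv_iff ha hc hb habc' hn hn2 hO.1).mp hO
    have hy := h.snd_mem_of_fst_notMem ha hc hb hn2 hO.1 hx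
    have hx' := (O.valuation_inv_lt_one_iff hx0).mpr hx
    refine ⟨hO.1, 1, by simp, fun j => ?_⟩
    fin_cases j
    · simpa [div_eq_mul_inv] using O.valuation_mul_lt_one_of_mem hy hx'
    · simp [div_self hx0]
    · simpa [h2] using hx'

end BranchesAtInfinity

/-! ### Assembly -/

theorem natCast_ne_zero_of_card_eq {F : Type*} [Field F] [Fintype F] {n d p h : ℕ}
    (hF : Fintype.card F = p ^ h) (hnd : p ^ h = n * d + 1) : (n : F) ≠ 0 := by
  have h0 : (p : F) ^ h = 0 := by
    rw [← Nat.cast_pow, ← hF]; exact FiniteField.cast_card_eq_zero F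
  have h1 : (p : F) ^ h = n * d + 1 := by exact_mod_cast congrArg (Nat.cast : ℕ → F) hnd
  rw [h0] at h1
  intro hn
  rw [hn] at h1
  simp at h1

end

theorem mainTheorem7 {F : Type*} [Field F] [Fintype F] (p h r : ℕ) (hp : p.Prime)
    (hF : Fintype.card F = p ^ h) (hrh : r ∣ h) (hlt : r < h)
    (k : Subfield F) (hk : Nat.card k = p ^ r)
    (a b c : F) (hak : a ∈ k) (hbk : b ∈ k) (hck : c ∈ k)
    (ha : a ≠ 0) (hb : b ≠ 0) (hc : c ≠ 0) (habc : c ≠ -(a / b))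
    (n m : ℕ) (hn : n = (p ^ h - 1) / (p ^ r - 1)) (hm : m = n) :
    ∃ _ : GeomIrreducible (genFermatAffine a b c n m),
      (numRationalPoints (genFermatAffine a b c n m) : ℤ)
          = (n : ℤ) ^ 2 * ((p : ℤ) ^ r - 3) + 4 * n ∧
      (∀ v : Fin 3 → AlgebraicClosure F, v ≠ 0 →
        (IsSingularPoint
            (MvPolynomial.map (algebraMap F (AlgebraicClosure F)) (genFermatProj a b c n m)) v ↔
          (v 1 = 0 ∧ v 2 = 0) ∨ (v 0 = 0 ∧ v 2 = 0))) ∧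
      IsOrdinaryMultiplePoint
        (MvPolynomial.map (algebraMap F (AlgebraicClosure F)) (genFermatProj a b c n m))
        ![1, 0, 0] n ∧
      IsOrdinaryMultiplePoint
        (MvPolynomial.map (algebraMap F (AlgebraicClosure F)) (genFermatProj a b c n m))
        ![0, 1, 0] n ∧
      (rationalBranchesAt (genFermatAffine a b c n m) ![1, 0, 0]).ncard = n ∧
      (rationalBranchesAt (genFermatAffine a b c n m) ![0, 1, 0]).ncard = n := by
  have hr : r ≠ 0 := by
    rintro rfl
    rw [zero_dvd_iff] at hrh
    omega
  have hpr : 1 < p ^ r := Nat.one_lt_pow hr hp.one_lt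
  have hprh : p ^ r < p ^ h := Nat.pow_lt_pow_right hp.one_lt hlt
  obtain ⟨d, hd⟩ : ∃ d, p ^ r = d + 1 := ⟨p ^ r - 1, by omega⟩
  have hdvd : p ^ r - 1 ∣ p ^ h - 1 := by
    obtain ⟨e, rfl⟩ := hrh
    rw [pow_mul]
    simpa using Nat.sub_dvd_pow_sub_pow (p ^ r) 1 e
  have hnd : p ^ h = n * d + 1 := by
    have h1 := Nat.div_mul_cancel hdvd
    rw [← hn, hd, Nat.add_sub_cancel] at h1
    omega
  -- If `n ≤ 1` then `p^h = n d + 1 ≤ p^r`, against `r < h`.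
  have hn2 : 2 ≤ n := by
    by_contra hlt2
    have : n * d ≤ 1 * d := Nat.mul_le_mul_right d (by omega)
    omega
  have hnF : (n : F) ≠ 0 := natCast_ne_zero_of_card_eq hF hnd
  have habc' : a + b * c ≠ 0 := by
    intro h0
    apply habc
    field_simp
    linear_combination h0
  clear hn
  subst hm
  have hcard : Fintype.card F = m * d + 1 := hF.trans hnd
  have hkd : Nat.card k = d + 1 := hk.trans hd
  have hroots : ∀ e ∈ k, e ≠ 0 → {t : F | t ^ m = e}.ncard = m := fun e he he0 =>
    FiniteField.ncard_pow_eq hcard (Subfield.pow_eq_one_of_natCard hkd he he0)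
  have hrb := hroots (-b / a) (k.div_mem (k.neg_mem hbk) hak) (div_ne_zero (neg_ne_zero.mpr hb) ha)
  have hrc := hroots (-c / a) (k.div_mem (k.neg_mem hck) hak) (div_ne_zero (neg_ne_zero.mpr hc) ha)
  have hG : GeomIrreducible (genFermatAffine a b c m m) :=
    geomIrreducible_genFermatAffine hc habc' hnF
  have hmodel := isPlaneModel_curveCoordinates (genFermatAffine a b c m m)
  have ha' : algebraMap F (AlgebraicClosure F) a ≠ 0 := by rwa [map_ne_zero]
  have hb' : algebraMap F (AlgebraicClosure F) b ≠ 0 := by rwa [map_ne_zero]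
  have hc' : algebraMap F (AlgebraicClosure F) c ≠ 0 := by rwa [map_ne_zero]
  have hm' : (m : AlgebraicClosure F) ≠ 0 := by
    rwa [← map_natCast (algebraMap F (AlgebraicClosure F)), map_ne_zero]
  refine ⟨hG, ?_, ?_, ?_, ?_, ?_, ?_⟩
  · have h1 := hmodel.ncard_degreeOnePlaces ha hb hc habc' hnF hn2 hrb hrc
    have h2 := ncard_genFermatPoints hcard hkd hak hbk hck ha hb hc habc' (by omega)
    have h3 : (p : ℤ) ^ r = d + 1 := by exact_mod_cast hd
    -- `rationalBranches` is by definition `degreeOnePlaces` of the function field.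
    change ((degreeOnePlaces F (CurveFunctionField (genFermatAffine a b c m m))).ncard : ℤ) = _
    rw [h1, h3]
    push_cast
    rw [h2]
    ring
  · intro v _
    rw [map_genFermatProj]
    refine isSingularPoint_genFermatProj_iff ha' hb' hc' ?_ hm' hn2 v
    rwa [← map_mul, ← map_add, map_ne_zero]
  · rw [map_genFermatProj]
    exact isOrdinaryMultiplePoint_genFermatProj_fst _ ha' hb' hm' hn2
  · rw [map_genFermatProj]
    exact isOrdinaryMultiplePoint_genFermatProj_snd _ ha' hc' hm' hn2
  · rw [rationalBranchesAt_fst_eq ha hb hc habc' hnF hn2]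
    exact (hmodel.finite_placesOver_inv_and_ncard ha hb habc' hnF hn2 hrb).2
  · rw [rationalBranchesAt_snd_eq ha hb hc habc' hnF hn2]
    exact (hmodel.swap.finite_placesOver_inv_and_ncard ha hc (by rwa [mul_comm c b]) hnF hn2 hrc).2
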